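/- Let $\mathbf M$ be a finite (non-empty) algebra. All relations and partial operations are finitary, arity $0$ is allowed, and algebras are non-empty. A relation $r\subseteq M^n$ is compatible with $\mathbf M$ if it forms a (non-empty) subalgebra of $\mathbf M^n$; a partial operation on $M$ is compatible with $\mathbf M$ if its graph is. An alter ego of $\mathbf M$ is a structure $\mathbb M=\langle M;H,R,\mathcal T\rangle$, where $H$ and $R$ are sets of partial operations and relations compatible with $\mathbf M$, and $\mathcal T$ is the discrete topology. Let $\mathcal A$ be the class of isomorphic copies of (non-empty) subalgebras of powers of $\mathbf M$ (including the zero power), and let $\mathcal X_{\mathbb M}$ be the class of isomorphic copies of topologically closed substructures (possibly empty) of non-zero powers of $\mathbb M$; morphisms of topological structures are the continuous maps that preserve the relations and the partial operations. For $\mathbf A\in\mathcal A$ let $D(\mathbf A)=\mathrm{Hom}(\mathbf A,\mathbf M)\le\mathbb M^{A}$, and for $\mathbb X\in\mathcal X_{\mathbb M}$ let $E(\mathbb X)=\mathrm{Hom}(\mathbb X,\mathbb M)\le\mathbf M^{X}$. The alter ego $\mathbb M$ *fully dualises* $\mathbf M$ if the evaluation maps $\mathbf A\to ED(\mathbf A)$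 and $\mathbb X\to DE(\mathbb X)$ are isomorphisms for all $\mathbf A\in\mathcal A$ and all $\mathbb X\in\mathcal X_{\mathbb M}$; it does so *at the finite level* if this holds for all finite $\mathbf A\in\mathcal A$ and all finite $\mathbb X\in\mathcal X_{\mathbb M}$. A Boolean structure of signature $(H,R)$ has a compact, Hausdorff, totally disconnected topology, continuous partial operations with closed domains, and closed relations. A universal Horn sentence has the form $\forall\vec v\,[(\alpha_1\,\&\cdots\&\,\alpha_\nu)\to\gamma]$, $\nu\ge 0$, with each $\alpha_i$ atomic and $\gamma$ atomic or $\bot$ (an atomic formula is true only if all terms in it are defined). The alter ego $\mathbb M$ is *standard* if $\mathcal X_{\mathbb M}$ is precisely the class of all Boolean structures of signature $(H,R)$ that satisfy every universal Horn sentence true in $\mathbb M$. **Theorem.** (1) Suppose that some standard alter ego fully dualises $\mathbf M$. Then every alter ego of $\mathbf M$ that fully dualises $\mathbf M$ at the finite level is standard and fully dualises $\mathbf M$. (2) In particular, if $\mathbf M$ is quasi-primal, that is, if the ternary discriminator $t$ on $M$ (given by $t(x,y,z)=x$ if $x\ne y$, and $t(x,y,z)=z$ if $x=y$) is a term function of $\mathbf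 M$, then every alter ego that fully dualises $\mathbf M$ at the finite level is standard and fully dualises $\mathbf M$. -/

import Mathlib

open scoped FirstOrder

universe u v w

namespace NatDual

/-! ## Algebras: powers and prevarieties

An algebra is a (non-empty) structure over a language without relation symbols. -/

section Algebras

variable (L : FirstOrder.Language.{v, w})

/-- The power `M ^ I`, with the coordinatewise structure. -/
instance powerStructure {M : Type u} [L.Structure M] {I : Type*} : L.Structure (I → M) where
  funMap f x := fun i => FirstOrder.Language.Structure.funMap f (fun k => x k i)
  RelMap r x := ∀ i, FirstOrder.Language.Structure.RelMap r (fun k => x k i)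

/-- `A` belongs to `ISP(M)`: it is isomorphic to a (non-empty) subalgebra of a power of `M`
(zero powers are allowed). -/
def InISP (M : Type u) [L.Structure M] (A : Type u) [L.Structure A] : Prop :=
  Nonempty A ∧ ∃ (I : Type u) (S : L.Substructure (I → M)), Nonempty (A ≃[L] S)

/-- An `n`-ary relation on `M` is compatible with the algebra `M` if it forms a (non-empty)
subalgebra of `M ^ n`. -/
def CompatRel {M : Type u} [L.Structure M] {n : ℕ} (r : Set (Fin n → M)) : Prop :=
  r.Nonempty ∧ ∃ S : L.Substructure (Fin n → M), (S : Set (Fin n → M)) = r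

/-- The graph of an `n`-ary partial operation, as an `(n+1)`-ary relation. -/
def graphRel {M : Type u} {n : ℕ} (h : (Fin n → M) →. M) : Set (Fin (n + 1) → M) :=
  {b | b (Fin.last n) ∈ h (fun i => b i.castSucc)}

/-- A partial operation is compatible with the algebra `M` if its graph is. -/
def CompatOp {M : Type u} [L.Structure M] {n : ℕ} (h : (Fin n → M) →. M) : Prop :=
  CompatRel L (graphRel h)

/-- A finite algebra is quasi-primal if its ternary discriminator is a term function. -/
def IsQuasiPrimal (M : Type u) [L.Structure M] : Prop :=
  Finite M ∧ ∃ t : L.Term (Fin 3), ∀ x y z : M,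
    (x ≠ y → t.realize ![x, y, z] = x) ∧ (x = y → t.realize ![x, y, z] = z)

variable {L}

theorem CompatRel.funMap_mem {M : Type u} [L.Structure M] {n : ℕ} {r : Set (Fin n → M)}
    (hr : CompatRel L r) {m : ℕ} (f : L.Functions m) (x : Fin m → Fin n → M)
    (hx : ∀ k, x k ∈ r) :
    (fun i => FirstOrder.Language.Structure.funMap f (fun k => x k i)) ∈ r := by
  obtain ⟨-, S, rfl⟩ := hr
  exact S.fun_mem f x hx

theorem CompatOp.funMap_mem {M : Type u} [L.Structure M] {n : ℕ} {h : (Fin n → M) →. M}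
    (hh : CompatOp L h) {m : ℕ} (f : L.Functions m) (x : Fin m → Fin n → M) (y : Fin m → M)
    (hxy : ∀ k, y k ∈ h (x k)) :
    FirstOrder.Language.Structure.funMap f y ∈ h (fun i => FirstOrder.Language.Structure.funMap f (fun k => x k i)) := by
  have := CompatRel.funMap_mem hh f (fun k => (Fin.snoc (x k) (y k) : Fin (n + 1) → M))
    (fun k => by simpa [graphRel] using hxy k)
  simpa [graphRel] using this

end Algebras

/-! ## Topological structures with partial operations -/

/-- A topological structure of signature `S`: the function symbols of `S` are interpreted as
partial operations, and the relation symbols as relations. -/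
structure TopStr (S : FirstOrder.Language.{u, u}) where
  carrier : Type u
  top : TopologicalSpace carrier
  op : ∀ {n : ℕ}, S.Functions n → ((Fin n → carrier) →. carrier)
  rel : ∀ {n : ℕ}, S.Relations n → Set (Fin n → carrier)

namespace TopStr

variable {S : FirstOrder.Language.{u, u}}

instance (X : TopStr S) : TopologicalSpace X.carrier := X.top

/-- Morphisms: continuous maps preserving the relations and the partial operations. -/
structure IsMorphism (X Y : TopStr S) (φ : X.carrier → Y.carrier) : Prop where
  continuous : Continuous φ
  map_op : ∀ {n : ℕ} (h : S.Functions n) (x : Fin n → X.carrier) (y : X.carrier),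
    y ∈ X.op h x → φ y ∈ Y.op h (fun k => φ (x k))
  map_rel : ∀ {n : ℕ} (r : S.Relations n) (x : Fin n → X.carrier),
    x ∈ X.rel r → (fun k => φ (x k)) ∈ Y.rel r

/-- Isomorphisms: morphisms with a two-sided inverse that is a morphism. -/
def IsIsomorphism (X Y : TopStr S) (φ : X.carrier → Y.carrier) : Prop :=
  IsMorphism X Y φ ∧ ∃ ψ : Y.carrier → X.carrier,
    IsMorphism Y X ψ ∧ Function.LeftInverse ψ φ ∧ Function.RightInverse ψ φ

/-- The power `Y ^ I`: product topology, and a partial operation is defined (a relation holds)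
precisely when it is defined (it holds) in each coordinate. -/
def power (Y : TopStr S) (I : Type u) : TopStr S where
  carrier := I → Y.carrier
  top := inferInstance
  op h x := ⟨∀ i, (Y.op h (fun k => x k i)).Dom, fun H i => (Y.op h (fun k => x k i)).get (H i)⟩
  rel r := {x | ∀ i, (fun k => x k i) ∈ Y.rel r}

/-- A subset of `Y` is the underlying set of a substructure if it is closed under the partial
operations of `Y`, wherever they are defined. -/
def OpClosed (Y : TopStr S) (s : Set Y.carrier) : Prop :=
  ∀ {n : ℕ} (h : S.Functions n) (x : Fin n → Y.carrier), (∀ k, x k ∈ s) →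
    ∀ y ∈ Y.op h x, y ∈ s

/-- The substructure of `Y` on `s`: all of the relations, the partial operations and their domains
are restricted to `s`, and the topology is the subspace topology. -/
def sub (Y : TopStr S) (s : Set Y.carrier) (hs : Y.OpClosed s) : TopStr S where
  carrier := s
  top := inferInstance
  op h x := ⟨(Y.op h (fun k => (x k).1)).Dom, fun H =>
    ⟨(Y.op h (fun k => (x k).1)).get H, hs h _ (fun k => (x k).2) _ (Part.get_mem H)⟩⟩
  rel r := {x | (fun k => (x k).1) ∈ Y.rel r}

/-- `X` belongs to the topological prevariety generated by `Y`: it is isomorphic to a topologically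
closed substructure of a non-zero power of `Y`. -/
def InIScP (Y X : TopStr S) : Prop :=
  ∃ (I : Type u) (_ : Nonempty I) (s : Set (Y.power I).carrier) (hs : (Y.power I).OpClosed s),
    IsClosed s ∧ ∃ φ : X.carrier → ((Y.power I).sub s hs).carrier,
      IsIsomorphism X ((Y.power I).sub s hs) φ

/-- Boolean structures: the topology is Boolean (compact, Hausdorff and totally disconnected), the
partial operations are continuous and have closed domains, and the relations are closed. -/
structure IsBoolean (X : TopStr S) : Prop where
  compact : CompactSpace X.carrier
  hausdorff : T2Space X.carrier
  totallyDisconnected : TotallyDisconnectedSpace X.carrier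
  closed_dom : ∀ {n : ℕ} (h : S.Functions n), IsClosed (X.op h).Dom
  continuous_op : ∀ {n : ℕ} (h : S.Functions n), Continuous (X.op h).asSubtype
  closed_rel : ∀ {n : ℕ} (r : S.Relations n), IsClosed (X.rel r)

/-! ### Universal Horn sentences -/

/-- The term `t` is defined in `X` under the assignment `a`, and has the value `y`. -/
def TermVal (X : TopStr S) {n : ℕ} (a : Fin n → X.carrier) : S.Term (Fin n) → X.carrier → Prop
  | .var i, y => y = a i
  | .func h ts, y => ∃ z, (∀ k, TermVal X a (ts k) (z k)) ∧ y ∈ X.op h z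

end TopStr

/-- Atomic formulas in the variables `v₀, …, vₙ₋₁`. -/
inductive Atomic (S : FirstOrder.Language.{u, u}) (n : ℕ) : Type u
  | eq (s t : S.Term (Fin n)) : Atomic S n
  | rel {k : ℕ} (r : S.Relations k) (ts : Fin k → S.Term (Fin n)) : Atomic S n

/-- Truth of an atomic formula in `X` under an assignment; in particular, all the terms that occur
in it have to be defined. -/
def Atomic.Holds {S : FirstOrder.Language.{u, u}} {n : ℕ} (X : TopStr S) (a : Fin n → X.carrier) :
    Atomic S n → Prop
  | .eq s t => ∃ y, X.TermVal a s y ∧ X.TermVal a t y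
  | .rel r ts => ∃ z, (∀ k, X.TermVal a (ts k) (z k)) ∧ z ∈ X.rel r

/-- Universal Horn sentences `∀ v₀ … vₙ₋₁, (α₁ & ⋯ & αₘ) → γ`, where the `αᵢ` are atomic, and `γ`
is atomic or (encoded as `none`) falsity. -/
structure UHSentence (S : FirstOrder.Language.{u, u}) where
  n : ℕ
  premise : List (Atomic S n)
  conclusion : Option (Atomic S n)

/-- Truth of a universal Horn sentence in a structure. -/
def TopStr.Models {S : FirstOrder.Language.{u, u}} (X : TopStr S) (σ : UHSentence S) : Prop :=
  ∀ a : Fin σ.n → X.carrier, (∀ α ∈ σ.premise, α.Holds X a) →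
    ∃ γ ∈ σ.conclusion, γ.Holds X a

/-! ## Alter egos and dualities -/

/-- An alter ego of the algebra `M`: a set of compatible partial operations and a set of compatible
relations on `M`, sorted by arity (the topology is understood to be the discrete one). -/
structure AlterEgo (L : FirstOrder.Language.{v, w}) (M : Type u) [L.Structure M] where
  H : ∀ n : ℕ, Set ((Fin n → M) →. M)
  R : ∀ n : ℕ, Set (Set (Fin n → M))
  compat_op : ∀ {n : ℕ}, ∀ h ∈ H n, CompatOp L h
  compat_rel : ∀ {n : ℕ}, ∀ r ∈ R n, CompatRel L r

namespace AlterEgo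

variable {L : FirstOrder.Language.{v, w}} {M : Type u} [L.Structure M]

/-- The signature `(H, R)`: each partial operation and relation serves as its own symbol. -/
def sig (𝕄 : AlterEgo L M) : FirstOrder.Language.{u, u} where
  Functions n := 𝕄.H n
  Relations n := 𝕄.R n

/-- The alter ego as a discrete topological structure. -/
def str (𝕄 : AlterEgo L M) : TopStr 𝕄.sig where
  carrier := M
  top := ⊥
  op h := h.1
  rel r := r.1

/-- An alter ego is standard if the members of its topological prevariety are precisely the Boolean
models of its universal Horn theory. -/
def IsStandard (𝕄 : AlterEgo L M) : Prop :=
  ∀ X : TopStr 𝕄.sig, 𝕄.str.InIScP X ↔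
    X.IsBoolean ∧ ∀ σ : UHSentence 𝕄.sig, 𝕄.str.Models σ → X.Models σ

variable [L.IsAlgebraic] (𝕄 : AlterEgo L M)

/-- The homomorphisms from `A` to `M` form a substructure of the power of the alter ego. -/
theorem opClosed_homs (A : Type u) [L.Structure A] :
    (𝕄.str.power A).OpClosed {x : A → M | ∃ f : A →[L] M, ⇑f = x} := by
  intro n h x hx y hy
  choose f hf using hx
  have hy' : ∀ a, (y a : M) ∈ h.1 (fun k => f k a) := by
    obtain rfl : x = fun k => ⇑(f k) := funext fun k => (hf k).symm
    obtain ⟨H, rfl⟩ := hy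
    exact fun a => Part.get_mem (H a)
  refine ⟨⟨y, fun {m} g b => ?_, fun r => isEmptyElim r⟩, rfl⟩
  have h1 := (𝕄.compat_op h.1 h.2).funMap_mem g (fun j k => f k (b j)) (fun j => y (b j))
    (fun j => hy' (b j))
  have h2 := hy' (FirstOrder.Language.Structure.funMap g b)
  simp only [FirstOrder.Language.Hom.map_fun] at h2
  exact Part.mem_unique h2 h1

/-- The dual `D(A)` of an algebra: the set of all homomorphisms from `A` to `M`, as a substructure
of the power `𝕄 ^ A`. -/
def dual (A : Type u) [L.Structure A] : TopStr 𝕄.sig :=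
  (𝕄.str.power A).sub {x : A → M | ∃ f : A →[L] M, ⇑f = x} (𝕄.opClosed_homs A)

/-- The dual `E(X)` of a topological structure: the set of all morphisms from `X` to `𝕄`, as a
subalgebra of the power `M ^ X`. -/
def predual (X : TopStr 𝕄.sig) : L.Substructure (X.carrier → M) where
  carrier := {u | TopStr.IsMorphism X 𝕄.str u}
  fun_mem := by
    intro m f u hu
    refine ⟨?_, ?_, ?_⟩
    · let _ : TopologicalSpace M := ⊥
      have : DiscreteTopology M := ⟨rfl⟩
      have h1 : Continuous (fun (x : X.carrier) (k : Fin m) => u k x) :=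
        continuous_pi (fun k => (hu k).continuous)
      exact (continuous_of_discreteTopology
        (f := fun z : Fin m → M => FirstOrder.Language.Structure.funMap f z)).comp h1
    · intro n h x y hy
      exact (𝕄.compat_op h.1 h.2).funMap_mem f (fun k i => u k (x i)) (fun k => u k y)
        (fun k => (hu k).map_op h x y hy)
    · intro n r x hx
      exact (𝕄.compat_rel r.1 r.2).funMap_mem f (fun k i => u k (x i))
        (fun k => (hu k).map_rel r x hx)

theorem isMorphism_eval (A : Type u) [L.Structure A] (a : A) :
    TopStr.IsMorphism (𝕄.dual A) 𝕄.str (fun x => x.1 a) := by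
  refine ⟨?_, ?_, ?_⟩
  · exact (continuous_apply a).comp continuous_subtype_val
  · rintro n h x y ⟨H, rfl⟩
    exact Part.get_mem (H a)
  · intro n r x hx
    exact hx a

/-- The evaluation map `e_A : A → ED(A)`. -/
def evalAlg (A : Type u) [L.Structure A] (a : A) : 𝕄.predual (𝕄.dual A) :=
  ⟨fun x => x.1 a, 𝕄.isMorphism_eval A a⟩

/-- The evaluation map `ε_X : X → DE(X)`. -/
def evalStr (X : TopStr 𝕄.sig) (x : X.carrier) : (𝕄.dual (𝕄.predual X)).carrier :=
  ⟨fun u => u.1 x, ⟨fun u => u.1 x, fun _ _ => rfl, fun r => isEmptyElim r⟩, rfl⟩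

/-- The evaluation map `e_A` is an isomorphism of algebras. -/
def EvalAlgIso (A : Type u) [L.Structure A] : Prop :=
  ∃ g : A ≃[L] 𝕄.predual (𝕄.dual A), ⇑g = 𝕄.evalAlg A

/-- The evaluation map `ε_X` is an isomorphism of topological structures. -/
def EvalStrIso (X : TopStr 𝕄.sig) : Prop :=
  TopStr.IsIsomorphism X (𝕄.dual (𝕄.predual X)) (𝕄.evalStr X)

/-- `𝕄` dualises `M`. -/
def Dualises : Prop :=
  ∀ (A : Type u) [L.Structure A], InISP L M A → 𝕄.EvalAlgIso A

/-- `𝕄` dualises `M` at the finite level. -/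
def DualisesFin : Prop :=
  ∀ (A : Type u) [L.Structure A], Finite A → InISP L M A → 𝕄.EvalAlgIso A

/-- `𝕄` fully dualises `M`. -/
def FullyDualises : Prop :=
  𝕄.Dualises ∧ ∀ X : TopStr 𝕄.sig, 𝕄.str.InIScP X → 𝕄.EvalStrIso X

/-- `𝕄` fully dualises `M` at the finite level. -/
def FullyDualisesFin : Prop :=
  𝕄.DualisesFin ∧ ∀ X : TopStr 𝕄.sig, Finite X.carrier → 𝕄.str.InIScP X → 𝕄.EvalStrIso X

end AlterEgo

end NatDual

/-!
Two ideas carry the proof: an alter ego that fully dualises at the finite level determines, on all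
models of its universal Horn theory, the structure of every other alter ego; and for a quasi-primal
algebra the compatible partial bijections form a standard alter ego that fully dualises.

*Change of the alter ego.* Let `𝕄` fully dualise `M` at the finite level, let `𝕄'` be standard and
fully dualise `M`, and let `X` be a Boolean model of the universal Horn theory of `𝕄`. As `M` is
finite, compactness of `M ^ X` shows that the maps `φ : X → 𝕄` that preserve the structure
(continuous or not) witness all failures of atomic formulas in `X`
(`TopStr.exists_preserves_not_holds`). So `X` acquires the structure of `𝕄'` from these maps
(`AlterEgo.transfer`). What makes this work is `AlterEgo.exists_preserves_dual_trace`: for a finite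
tuple `a` of `X`, with `B ≤ M ^ n` the algebra of its values under all such `φ`, there is a map
`D(B) → X` that preserves the structure of `𝕄` and sends the coordinate projections to `a`. It uses
that, by fullness at the finite level, homomorphisms on sets defined by atomic formulas are term
functions of `𝕄`. As `𝕄` dualises at the finite level, maps `D(B) → 𝕄` respect all compatible
relations, so the map `D(B) → X` also preserves the structure of `𝕄'`. It follows that `X` with its
new structure is a Boolean model of the universal Horn theory of `𝕄'`, with the same morphisms into
`M` as before. Standardness and full duality of `𝕄'` then apply to it, and return to `X`.

*Quasi-primal algebras.* For the alter ego `partialIsos` of compatible nullary operations and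
injective unary partial operations, a Boolean model `X` of the Horn theory is a Boolean space with a
partial action of partial bijections. Continuous equivariant maps to `M` extend from closed
invariant subsets of `X` (`IsPartialAction.exists_extend`), which gives enough morphisms to separate
the structure of `X`: the alter ego is standard. With the discriminator, a binary compatible
relation is rectangular or the graph of a partial bijection, so that morphisms `D(A) → M` agree with
evaluations at any two points, hence everywhere by Baker–Pixley interpolation and compactness. A
homomorphism `E(X) → M` has the same kernel as the evaluation at some point of `X`, and is therefore
the evaluation at the image of this point under a partial bijection; the constant homomorphisms are
the evaluations at the nullary operations.
-/

namespace NatDual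

/-! ### Maps that preserve partial operations and relations, and universal Horn logic -/

namespace TopStr

variable {S : FirstOrder.Language.{u, u}} {X Y Z : TopStr S}

/-- `φ` preserves the relations and the partial operations; unlike for a morphism, continuity is
not required. -/
structure Preserves (X Y : TopStr S) (φ : X.carrier → Y.carrier) : Prop where
  map_op : ∀ {n : ℕ} (h : S.Functions n) (x : Fin n → X.carrier) (y : X.carrier),
    y ∈ X.op h x → φ y ∈ Y.op h (fun k => φ (x k))
  map_rel : ∀ {n : ℕ} (r : S.Relations n) (x : Fin n → X.carrier),
    x ∈ X.rel r → (fun k => φ (x k)) ∈ Y.rel r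

/-- `φ` preserves those instances of the partial operations and relations of `X` all of whose
entries lie in `s`. -/
structure PreservesOn (X Y : TopStr S) (s : Set X.carrier) (φ : X.carrier → Y.carrier) : Prop where
  map_op : ∀ {n : ℕ} (h : S.Functions n) (x : Fin n → X.carrier) (y : X.carrier),
    (∀ k, x k ∈ s) → y ∈ s → y ∈ X.op h x → φ y ∈ Y.op h (fun k => φ (x k))
  map_rel : ∀ {n : ℕ} (r : S.Relations n) (x : Fin n → X.carrier),
    (∀ k, x k ∈ s) → x ∈ X.rel r → (fun k => φ (x k)) ∈ Y.rel r

theorem IsMorphism.preserves {φ : X.carrier → Y.carrier} (h : IsMorphism X Y φ) :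
    Preserves X Y φ :=
  ⟨h.map_op, h.map_rel⟩

theorem Preserves.isMorphism {φ : X.carrier → Y.carrier} (h : Preserves X Y φ)
    (hc : Continuous φ) : IsMorphism X Y φ :=
  ⟨hc, h.map_op, h.map_rel⟩

theorem Preserves.comp {ψ : Y.carrier → Z.carrier} {φ : X.carrier → Y.carrier}
    (hψ : Preserves Y Z ψ) (hφ : Preserves X Y φ) : Preserves X Z (fun x => ψ (φ x)) :=
  ⟨fun h x y hy => hψ.map_op h _ _ (hφ.map_op h x y hy),
    fun r x hx => hψ.map_rel r _ (hφ.map_rel r x hx)⟩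

theorem PreservesOn.mono {s t : Set X.carrier} {φ : X.carrier → Y.carrier}
    (h : PreservesOn X Y t φ) (hst : s ⊆ t) : PreservesOn X Y s φ :=
  ⟨fun g x y hx hy => h.map_op g x y (fun k => hst (hx k)) (hst hy),
    fun r x hx => h.map_rel r x (fun k => hst (hx k))⟩

theorem termVal_var {n : ℕ} {a : Fin n → X.carrier} {i : Fin n} {y : X.carrier} :
    X.TermVal a (.var i) y ↔ y = a i := Iff.rfl

theorem TermVal.unique {n : ℕ} {a : Fin n → X.carrier} {t : S.Term (Fin n)} {y z : X.carrier}
    (hy : X.TermVal a t y) (hz : X.TermVal a t z) : y = z := by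
  induction t generalizing y z with
  | var i => exact hy.trans hz.symm
  | func h ts ih =>
    obtain ⟨p, hp, hy⟩ := hy
    obtain ⟨q, hq, hz⟩ := hz
    obtain rfl : p = q := funext fun k => ih k (hp k) (hq k)
    exact Part.mem_unique hy hz

theorem Preserves.termVal {φ : X.carrier → Y.carrier} (hφ : Preserves X Y φ) {n : ℕ}
    {a : Fin n → X.carrier} {t : S.Term (Fin n)} {y : X.carrier} (hy : X.TermVal a t y) :
    Y.TermVal (fun k => φ (a k)) t (φ y) := by
  induction t generalizing y with
  | var i => exact congrArg φ hy
  | func h ts ih =>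
    obtain ⟨p, hp, hy⟩ := hy
    exact ⟨fun k => φ (p k), fun k => ih k (hp k), hφ.map_op h p y hy⟩

theorem Preserves.holds {φ : X.carrier → Y.carrier} (hφ : Preserves X Y φ) {n : ℕ}
    {a : Fin n → X.carrier} {α : Atomic S n} (h : α.Holds X a) :
    α.Holds Y (fun k => φ (a k)) := by
  cases α with
  | eq s t =>
    obtain ⟨y, hs, ht⟩ := h
    exact ⟨φ y, hφ.termVal hs, hφ.termVal ht⟩
  | rel r ts =>
    obtain ⟨z, hz, hr⟩ := h
    exact ⟨fun k => φ (z k), fun k => hφ.termVal (hz k), hφ.map_rel r z hr⟩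

theorem termVal_relabel {n m : ℕ} {a : Fin m → X.carrier} (j : Fin n → Fin m)
    {t : S.Term (Fin n)} {y : X.carrier} :
    X.TermVal a (t.relabel j) y ↔ X.TermVal (fun k => a (j k)) t y := by
  induction t generalizing y with
  | var i => exact Iff.rfl
  | func h ts ih =>
    exact exists_congr fun z => and_congr_left fun _ => forall_congr' fun k => ih k

end TopStr

/-- Substitution of variables in an atomic formula. -/
def Atomic.relabel {S : FirstOrder.Language.{u, u}} {n m : ℕ} (j : Fin n → Fin m) :
    Atomic S n → Atomic S m
  | .eq s t => .eq (s.relabel j) (t.relabel j)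
  | .rel r ts => .rel r fun k => (ts k).relabel j

theorem Atomic.holds_relabel {S : FirstOrder.Language.{u, u}} {X : TopStr S} {n m : ℕ}
    {a : Fin m → X.carrier} (j : Fin n → Fin m) {α : Atomic S n} :
    (α.relabel j).Holds X a ↔ α.Holds X (fun k => a (j k)) := by
  cases α with
  | eq s t =>
    exact exists_congr fun y => and_congr (TopStr.termVal_relabel j) (TopStr.termVal_relabel j)
  | rel r ts =>
    exact exists_congr fun z => and_congr_left fun _ => forall_congr' fun k =>
      TopStr.termVal_relabel j

namespace TopStr

variable {S : FirstOrder.Language.{u, u}} {X Y : TopStr S}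

/-- The Horn theory of a finite structure also controls implications with infinitely many atomic
premises: finitely many premises suffice, one for each assignment that has to be excluded. -/
theorem exists_assignment [Finite Y.carrier] (hX : ∀ σ : UHSentence S, Y.Models σ → X.Models σ)
    {n : ℕ} (a : Fin n → X.carrier) (γ : Option (Atomic S n)) (hγ : ∀ γ' ∈ γ, ¬ γ'.Holds X a) :
    ∃ p : Fin n → Y.carrier, (∀ α : Atomic S n, α.Holds X a → α.Holds Y p) ∧
      ∀ γ' ∈ γ, ¬ γ'.Holds Y p := by
  classical
  by_contra! hcon
  let T := {p : Fin n → Y.carrier // ∃ α : Atomic S n, α.Holds X a ∧ ¬ α.Holds Y p}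
  have : Fintype T := Fintype.ofFinite T
  choose f hf using fun p : T => p.2
  let σ : UHSentence S := ⟨n, (Finset.univ : Finset T).toList.map f, γ⟩
  have hσ : Y.Models σ := by
    intro p hp
    obtain ⟨γ', h1, h2⟩ := hcon p (by
      intro α hα
      by_contra hα'
      have hT : ∃ α : Atomic S n, α.Holds X a ∧ ¬ α.Holds Y p := ⟨α, hα, hα'⟩
      exact (hf ⟨p, hT⟩).2 (hp _ (by simp [σ])))
    exact ⟨γ', h1, h2⟩
  obtain ⟨γ', h1, h2⟩ := hX σ hσ a (by
    intro α hα
    simp only [σ, List.mem_map] at hα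
    obtain ⟨p, -, rfl⟩ := hα
    exact (hf p).1)
  exact hγ γ' h1 h2

/-- Compactness of `Y ^ X` for finite `Y`. -/
theorem exists_preserves_of_forall_finset [Finite Y.carrier] [DiscreteTopology Y.carrier] {n : ℕ}
    (a : Fin n → X.carrier) (P : Set (Fin n → Y.carrier))
    (h : ∀ F : Finset X.carrier, ∃ φ, PreservesOn X Y F φ ∧ (fun k => φ (a k)) ∈ P) :
    ∃ φ, Preserves X Y φ ∧ (fun k => φ (a k)) ∈ P := by
  classical
  let C : Finset X.carrier → Set (X.carrier → Y.carrier) :=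
    fun F => {φ | PreservesOn X Y F φ ∧ (fun k => φ (a k)) ∈ P}
  have hcl : ∀ F, IsClosed (C F) := by
    intro F
    have key : ∀ {m : ℕ} (x : Fin m → X.carrier) (R : Set (Fin m → Y.carrier)),
        IsClosed {φ : X.carrier → Y.carrier | (fun k => φ (x k)) ∈ R} := fun x R =>
      (isClosed_discrete R).preimage
        (f := fun (φ : X.carrier → Y.carrier) k => φ (x k)) (by fun_prop)
    have h1 : C F =
        (⋂ (n : ℕ) (g : S.Functions n) (x : Fin n → X.carrier) (y : X.carrier)
          (_ : ∀ k, x k ∈ F) (_ : y ∈ F) (_ : y ∈ X.op g x),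
          {φ : X.carrier → Y.carrier | φ y ∈ Y.op g (fun k => φ (x k))}) ∩
        (⋂ (n : ℕ) (r : S.Relations n) (x : Fin n → X.carrier)
          (_ : ∀ k, x k ∈ F) (_ : x ∈ X.rel r),
          {φ : X.carrier → Y.carrier | (fun k => φ (x k)) ∈ Y.rel r}) ∩
        {φ : X.carrier → Y.carrier | (fun k => φ (a k)) ∈ P} := by
      ext φ
      simp only [C, Set.mem_ofPred_eq, Set.mem_inter_iff, Set.mem_iInter]
      refine and_congr_left fun _ => ⟨fun h => ⟨?_, ?_⟩, fun h => ⟨?_, ?_⟩⟩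
      · exact fun n g x y => h.map_op g x y
      · exact fun n g x => h.map_rel g x
      · exact fun g x y => h.1 _ g x y
      · exact fun g x => h.2 _ g x
    rw [h1]
    refine IsClosed.inter (IsClosed.inter ?_ ?_) (key a P)
    · refine isClosed_iInter fun n => isClosed_iInter fun g => isClosed_iInter fun x =>
        isClosed_iInter fun y => isClosed_iInter fun _ => isClosed_iInter fun _ =>
        isClosed_iInter fun _ => ?_
      simpa using key (Fin.snoc x y : Fin (n + 1) → X.carrier)
        {b | b (Fin.last n) ∈ Y.op g (fun k => b k.castSucc)}
    · exact isClosed_iInter fun n => isClosed_iInter fun g => isClosed_iInter fun x =>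
        isClosed_iInter fun _ => isClosed_iInter fun _ => key x _
  have hmono : ∀ {F G : Finset X.carrier}, F ⊆ G → C G ⊆ C F := fun hFG φ hφ =>
    ⟨hφ.1.mono (by exact_mod_cast hFG), hφ.2⟩
  obtain ⟨φ, hφ⟩ := IsCompact.nonempty_iInter_of_directed_nonempty_isCompact_isClosed C
    (fun F G => ⟨F ∪ G, hmono Finset.subset_union_left, hmono Finset.subset_union_right⟩) h
    (fun F => (hcl F).isCompact) hcl
  rw [Set.mem_iInter] at hφ
  refine ⟨φ, ⟨fun {m} g x y hy => ?_, fun {m} r x hx => ?_⟩, (hφ ∅).2⟩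
  · exact (hφ (insert y (Finset.univ.image x))).1.map_op g x y (by simp) (by simp) hy
  · exact (hφ (Finset.univ.image x)).1.map_rel r x (by simp) hx

/-- If an assignment satisfies all atomic formulas that hold in `X` under `b`, then each map that
extends it preserves the structure on the range of `b`. -/
theorem preservesOn_of_atomic {m : ℕ} {b : Fin m → X.carrier}
    {p : Fin m → Y.carrier} (hp : ∀ α : Atomic S m, α.Holds X b → α.Holds Y p)
    {φ : X.carrier → Y.carrier} (hφ : ∀ i, φ (b i) = p i) :
    PreservesOn X Y (Set.range b) φ := by
  refine ⟨fun {k} g x y hx hy hxy => ?_, fun {k} r x hx hxr => ?_⟩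
  · choose i hi using hx
    obtain ⟨j, rfl⟩ := hy
    obtain rfl : (fun k => b (i k)) = x := funext hi
    obtain ⟨z, ⟨q, hq, hz⟩, hz'⟩ := hp (.eq (.func g fun k => .var (i k)) (.var j))
      ⟨b j, ⟨fun k => b (i k), fun k => rfl, hxy⟩, rfl⟩
    obtain rfl : q = fun k => p (i k) := funext hq
    obtain rfl : z = p j := hz'
    simpa only [hφ] using hz
  · choose i hi using hx
    obtain rfl : (fun k => b (i k)) = x := funext hi
    obtain ⟨q, hq, hz⟩ := hp (.rel r fun k => .var (i k)) ⟨fun k => b (i k), fun k => rfl, hxr⟩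
    obtain rfl : q = fun k => p (i k) := funext hq
    simpa only [hφ] using hz

theorem exists_extension {m : ℕ} [Nonempty Y.carrier] {b : Fin m → X.carrier}
    (hb : Function.Injective b) (p : Fin m → Y.carrier) :
    ∃ φ : X.carrier → Y.carrier, ∀ i, φ (b i) = p i :=
  ⟨Function.extend b p fun _ => Classical.arbitrary _, fun i => hb.extend_apply _ _ i⟩

theorem exists_enum (F : Finset X.carrier) :
    ∃ (m : ℕ) (b : Fin m → X.carrier), Function.Injective b ∧ Set.range b = F := by
  refine ⟨F.card, fun i => (F.equivFin.symm i).1,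
    Subtype.val_injective.comp F.equivFin.symm.injective, ?_⟩
  ext x
  constructor
  · rintro ⟨i, rfl⟩
    exact (F.equivFin.symm i).2
  · intro hx
    exact ⟨F.equivFin ⟨x, hx⟩, by simp⟩

/-- A model `X` of the universal Horn theory of the finite structure `Y` has enough maps into `Y`:
each failure of an atomic formula in `X` is witnessed by a map that preserves the structure. For
`γ = none` this says that there is at least one such map. -/
theorem exists_preserves_not_holds [Finite Y.carrier] [DiscreteTopology Y.carrier]
    [Nonempty Y.carrier] (hX : ∀ σ : UHSentence S, Y.Models σ → X.Models σ) {n : ℕ}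
    (a : Fin n → X.carrier) (γ : Option (Atomic S n)) (hγ : ∀ γ' ∈ γ, ¬ γ'.Holds X a) :
    ∃ φ, Preserves X Y φ ∧ ∀ γ' ∈ γ, ¬ γ'.Holds Y (fun k => φ (a k)) := by
  classical
  refine exists_preserves_of_forall_finset a {q | ∀ γ' ∈ γ, ¬ γ'.Holds Y q} fun F => ?_
  obtain ⟨m, b, hb, hbF⟩ := exists_enum (F ∪ Finset.univ.image a)
  have hab : ∀ k, ∃ i, b i = a k := fun k => by
    rw [← Set.mem_range, hbF]; simp
  choose j hj using hab
  obtain rfl : (fun k => b (j k)) = a := funext hj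
  obtain ⟨p, hp, hpγ⟩ := exists_assignment hX b (γ.map (Atomic.relabel j)) (by
    simpa [Atomic.holds_relabel] using hγ)
  obtain ⟨φ, hφ⟩ := exists_extension hb p
  refine ⟨φ, (preservesOn_of_atomic hp hφ).mono ?_, ?_⟩
  · rw [hbF]; simp
  · simp only [Set.mem_ofPred_eq, hφ]
    simpa [Atomic.holds_relabel] using hpγ

theorem holds_of_forall_preserves [Finite Y.carrier] [DiscreteTopology Y.carrier]
    [Nonempty Y.carrier] (hX : ∀ σ : UHSentence S, Y.Models σ → X.Models σ) {n : ℕ}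
    (a : Fin n → X.carrier) (γ : Atomic S n)
    (h : ∀ φ, Preserves X Y φ → γ.Holds Y (fun k => φ (a k))) : γ.Holds X a := by
  by_contra hγ
  obtain ⟨φ, h1, h2⟩ := exists_preserves_not_holds hX a (some γ) (by simpa using hγ)
  exact h2 γ rfl (h φ h1)

theorem exists_preserves [Finite Y.carrier] [DiscreteTopology Y.carrier]
    [Nonempty Y.carrier] (hX : ∀ σ : UHSentence S, Y.Models σ → X.Models σ) :
    ∃ φ, Preserves X Y φ :=
  (exists_preserves_not_holds (n := 0) hX Fin.elim0 none (by simp)).imp fun _ h => h.1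

theorem eq_of_forall_preserves [Finite Y.carrier] [DiscreteTopology Y.carrier]
    [Nonempty Y.carrier] (hX : ∀ σ : UHSentence S, Y.Models σ → X.Models σ) {x y : X.carrier}
    (h : ∀ φ, Preserves X Y φ → φ x = φ y) : x = y := by
  obtain ⟨z, hz, hz'⟩ := holds_of_forall_preserves hX ![x, y] (.eq (.var 0) (.var 1))
    fun φ hφ => ⟨φ x, rfl, h φ hφ⟩
  exact hz.symm.trans hz'

theorem mem_op_of_forall_preserves [Finite Y.carrier] [DiscreteTopology Y.carrier]
    [Nonempty Y.carrier] (hX : ∀ σ : UHSentence S, Y.Models σ → X.Models σ) {n : ℕ}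
    (g : S.Functions n) (x : Fin n → X.carrier) (y : X.carrier)
    (h : ∀ φ, Preserves X Y φ → φ y ∈ Y.op g (fun k => φ (x k))) : y ∈ X.op g x := by
  obtain ⟨z, ⟨q, hq, hz⟩, hz'⟩ := holds_of_forall_preserves hX (Fin.snoc x y : Fin (n + 1) → _)
    (.eq (.func g fun k => .var k.castSucc) (.var (Fin.last n)))
    fun φ hφ => ⟨φ y, ⟨fun k => φ (x k), fun k => by simp [termVal_var], h φ hφ⟩,
      by simp [termVal_var]⟩
  obtain rfl : q = x := funext fun k => by simpa [termVal_var] using hq k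
  obtain rfl : z = y := by simpa [termVal_var] using hz'
  exact hz

theorem exists_mem_op_of_forall_preserves [Finite Y.carrier] [DiscreteTopology Y.carrier]
    [Nonempty Y.carrier] (hX : ∀ σ : UHSentence S, Y.Models σ → X.Models σ) {n : ℕ}
    (g : S.Functions n) (x : Fin n → X.carrier)
    (h : ∀ φ, Preserves X Y φ → ∃ z, z ∈ Y.op g (fun k => φ (x k))) : ∃ y, y ∈ X.op g x := by
  obtain ⟨z, ⟨q, hq, hz⟩, -⟩ := holds_of_forall_preserves hX x
    (.eq (.func g fun k => .var k) (.func g fun k => .var k))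
    fun φ hφ => by
      obtain ⟨z, hz⟩ := h φ hφ
      exact ⟨z, ⟨_, fun k => rfl, hz⟩, ⟨_, fun k => rfl, hz⟩⟩
  obtain rfl : q = x := funext hq
  exact ⟨z, hz⟩

/-! ### Boolean structures and topological prevarieties -/

/-- In a Boolean structure the graphs of the partial operations are closed. -/
theorem IsBoolean.isClosed_graph (hX : X.IsBoolean) {n : ℕ} (g : S.Functions n) :
    IsClosed {p : (Fin n → X.carrier) × X.carrier | p.2 ∈ X.op g p.1} := by
  have := hX.compact
  have := hX.hausdorff
  have hc : IsCompact ((X.op g).Dom) := (hX.closed_dom g).isCompact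
  have : CompactSpace (X.op g).Dom := isCompact_iff_compactSpace.1 hc
  have : {p : (Fin n → X.carrier) × X.carrier | p.2 ∈ X.op g p.1} =
      Set.range fun x : (X.op g).Dom => (x.1, (X.op g).asSubtype x) := by
    ext ⟨x, y⟩
    constructor
    · rintro ⟨H, h⟩
      exact ⟨⟨x, H⟩, Prod.ext rfl h⟩
    · rintro ⟨⟨x', H⟩, h⟩
      simp only [Prod.mk.injEq] at h
      obtain ⟨rfl, rfl⟩ := h
      exact ⟨H, rfl⟩
  rw [this]
  exact (isCompact_range (continuous_subtype_val.prodMk (hX.continuous_op g))).isClosed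

/-- For a compact topology, closed graphs are enough for the partial operations of a Boolean
structure. -/
theorem IsBoolean.of_isClosed_graph (hc : CompactSpace X.carrier) (h2 : T2Space X.carrier)
    (ht : TotallyDisconnectedSpace X.carrier)
    (hop : ∀ {n : ℕ} (g : S.Functions n),
      IsClosed {p : (Fin n → X.carrier) × X.carrier | p.2 ∈ X.op g p.1})
    (hrel : ∀ {n : ℕ} (r : S.Relations n), IsClosed (X.rel r)) : X.IsBoolean := by
  refine ⟨hc, h2, ht, fun {n} g => ?_, fun {n} g => ?_, hrel⟩
  · have : (X.op g).Dom =
        Prod.fst '' {p : (Fin n → X.carrier) × X.carrier | p.2 ∈ X.op g p.1} := by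
      ext x
      constructor
      · exact fun H => ⟨(x, (X.op g x).get H), Part.get_mem H, rfl⟩
      · rintro ⟨⟨x', y⟩, ⟨H, -⟩, rfl⟩
        exact H
    rw [this]
    exact isClosedMap_fst_of_compactSpace _ (hop g)
  · rw [continuous_iff_isClosed]
    intro C hC
    have : (X.op g).asSubtype ⁻¹' C = Subtype.val ⁻¹'
        (Prod.fst '' ({p : (Fin n → X.carrier) × X.carrier | p.2 ∈ X.op g p.1} ∩
          Prod.snd ⁻¹' C)) := by
      ext ⟨x, H⟩
      constructor
      · exact fun h => ⟨(x, (X.op g x).get H), ⟨Part.get_mem H, h⟩, rfl⟩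
      · rintro ⟨⟨x', y⟩, ⟨⟨H', hy⟩, h⟩, rfl⟩
        change (X.op g x').get H' ∈ C
        rw [show (X.op g x').get H' = y from hy]
        exact h
    rw [this]
    exact (isClosedMap_fst_of_compactSpace _
      ((hop g).inter (hC.preimage continuous_snd))).preimage continuous_subtype_val

theorem mem_op_sub_power {I : Type u} {s : Set (Y.power I).carrier}
    {hs : (Y.power I).OpClosed s} {n : ℕ} {g : S.Functions n}
    {x : Fin n → ((Y.power I).sub s hs).carrier} {y : ((Y.power I).sub s hs).carrier} :
    y ∈ ((Y.power I).sub s hs).op g x ↔ ∀ i, y.1 i ∈ Y.op g (fun k => (x k).1 i) := by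
  constructor
  · rintro ⟨H, rfl⟩ i
    exact Part.get_mem (H i)
  · intro h
    choose H hH using h
    exact ⟨H, Subtype.ext (funext hH)⟩

theorem preserves_apply {I : Type u} {s : Set (Y.power I).carrier}
    {hs : (Y.power I).OpClosed s} (i : I) :
    Preserves ((Y.power I).sub s hs) Y (fun x => x.1 i) :=
  ⟨fun _ _ _ hy => mem_op_sub_power.1 hy i, fun _ _ hx => hx i⟩

/-- A term has a value in a substructure of a power if it has a value in each coordinate. -/
theorem exists_termVal_sub_power {I : Type u} {s : Set (Y.power I).carrier}
    {hs : (Y.power I).OpClosed s} {n : ℕ} {a : Fin n → ((Y.power I).sub s hs).carrier}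
    {t : S.Term (Fin n)} (h : ∀ i, ∃ z, Y.TermVal (fun k => (a k).1 i) t z) :
    ∃ y, ((Y.power I).sub s hs).TermVal a t y := by
  induction t with
  | var i => exact ⟨a i, rfl⟩
  | func g ts ih =>
    choose z q hq hz using h
    have h1 : ∀ k, ∃ y, ((Y.power I).sub s hs).TermVal a (ts k) y := fun k =>
      ih k fun i => ⟨_, hq i k⟩
    choose y hy using h1
    have h2 : ∀ i, (fun k => (y k).1 i) = q i := fun i => funext fun k =>
      ((preserves_apply i).termVal (hy k)).unique (hq i k)
    have h3 : ∀ i, z i ∈ Y.op g (fun k => (y k).1 i) := fun i => by rw [h2]; exact hz i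
    have h4 : (z : (Y.power I).carrier) ∈ s :=
      hs g (fun k => (y k).1) (fun k => (y k).2) z
        ⟨fun i => (h3 i).1, funext fun i => (h3 i).2⟩
    exact ⟨⟨z, h4⟩, y, hy, mem_op_sub_power.2 h3⟩

/-- Atomic formulas hold in a substructure of a power as soon as they hold in each coordinate. -/
theorem holds_sub_power {I : Type u} {s : Set (Y.power I).carrier}
    {hs : (Y.power I).OpClosed s} {n : ℕ} {a : Fin n → ((Y.power I).sub s hs).carrier}
    {α : Atomic S n} (h : ∀ i, α.Holds Y (fun k => (a k).1 i)) :
    α.Holds ((Y.power I).sub s hs) a := by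
  cases α with
  | eq p q =>
    choose z hp hq using h
    obtain ⟨y, hy⟩ := exists_termVal_sub_power fun i => ⟨z i, hp i⟩
    obtain ⟨y', hy'⟩ := exists_termVal_sub_power fun i => ⟨z i, hq i⟩
    have : y = y' := Subtype.ext <| funext fun i =>
      (((preserves_apply i).termVal hy).unique (hp i)).trans
        (((preserves_apply i).termVal hy').unique (hq i)).symm
    exact ⟨y, hy, this ▸ hy'⟩
  | rel r ts =>
    choose z hz hr using h
    choose y hy using fun k => exists_termVal_sub_power fun i => ⟨z i k, hz i k⟩
    have h2 : ∀ i, (fun k => (y k).1 i) = z i := fun i => funext fun k =>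
      ((preserves_apply i).termVal (hy k)).unique (hz i k)
    refine ⟨y, hy, fun i => ?_⟩
    change (fun k => (y k).1 i) ∈ Y.rel r
    rw [h2]
    exact hr i

theorem continuous_val_sub_power {I : Type u} {s : Set (Y.power I).carrier}
    {hs : (Y.power I).OpClosed s} :
    Continuous (fun (x : ((Y.power I).sub s hs).carrier) (i : I) => (x.1 i : Y.carrier)) :=
  continuous_subtype_val (p := fun x : (Y.power I).carrier => x ∈ s)

/-- A member of the topological prevariety of `Y`, described by a family of morphisms into `Y`. -/
theorem InIScP.exists_family (h : Y.InIScP X) :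
    ∃ (I : Type u) (_ : Nonempty I) (e : I → X.carrier → Y.carrier),
      (∀ i, IsMorphism X Y (e i)) ∧
      Topology.IsClosedEmbedding (fun x i => e i x) ∧
      (∀ {n : ℕ} (g : S.Functions n) (x : Fin n → X.carrier),
        (∀ i, ∃ z, z ∈ Y.op g (fun k => e i (x k))) → ∃ y, y ∈ X.op g x) ∧
      (∀ {n : ℕ} (r : S.Relations n) (x : Fin n → X.carrier),
        (∀ i, (fun k => e i (x k)) ∈ Y.rel r) → x ∈ X.rel r) := by
  obtain ⟨I, hI, s, hs, hcl, φ, hφ, ψ, hψ, h1, h2⟩ := h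
  refine ⟨I, hI, fun i x => (φ x).1 i, fun i => ?_, ?_, ?_, ?_⟩
  · exact ((preserves_apply i).comp hφ.preserves).isMorphism
      ((continuous_apply i).comp (continuous_val_sub_power.comp hφ.continuous))
  · exact hcl.isClosedEmbedding_subtypeVal.comp
      (⟨⟨φ, ψ, h1, h2⟩, hφ.continuous, hψ.continuous⟩ :
        X.carrier ≃ₜ ((Y.power I).sub s hs).carrier).isClosedEmbedding
  · intro n g x hx
    have H : (((Y.power I).sub s hs).op g (fun k => φ (x k))).Dom := fun i => by
      obtain ⟨z, H, -⟩ := hx i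
      exact H
    have h3 := hψ.map_op g _ _ (Part.get_mem H)
    simp only [h1 _] at h3
    exact ⟨_, h3⟩
  · intro n r x hx
    have h3 := hψ.map_rel r (fun k => φ (x k)) hx
    simpa only [h1 _] using h3

theorem mem_op_of_family {I : Type u} {e : I → X.carrier → Y.carrier}
    (he : ∀ i, Preserves X Y (e i)) (hinj : Function.Injective fun x i => e i x)
    (hop : ∀ {n : ℕ} (g : S.Functions n) (x : Fin n → X.carrier),
        (∀ i, ∃ z, z ∈ Y.op g (fun k => e i (x k))) → ∃ y, y ∈ X.op g x)
    {n : ℕ} (g : S.Functions n) (x : Fin n → X.carrier) (y : X.carrier)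
    (hy : ∀ i, e i y ∈ Y.op g (fun k => e i (x k))) : y ∈ X.op g x := by
  obtain ⟨y', hy'⟩ := hop g x fun i => ⟨_, hy i⟩
  obtain rfl : y' = y := hinj <| funext fun i =>
    Part.mem_unique ((he i).map_op g x y' hy') (hy i)
  exact hy'

theorem InIScP.of_family [Finite Y.carrier] [DiscreteTopology Y.carrier] [CompactSpace X.carrier]
    {I : Type u} [hI : Nonempty I] {e : I → X.carrier → Y.carrier}
    (he : ∀ i, IsMorphism X Y (e i)) (hinj : Function.Injective fun x i => e i x)
    (hop : ∀ {n : ℕ} (g : S.Functions n) (x : Fin n → X.carrier),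
        (∀ i, ∃ z, z ∈ Y.op g (fun k => e i (x k))) → ∃ y, y ∈ X.op g x)
    (hrel : ∀ {n : ℕ} (r : S.Relations n) (x : Fin n → X.carrier),
        (∀ i, (fun k => e i (x k)) ∈ Y.rel r) → x ∈ X.rel r) : Y.InIScP X := by
  let E : X.carrier → (Y.power I).carrier := fun x i => e i x
  have hE : Continuous E := continuous_pi fun i => (he i).continuous
  have : T2Space (Y.power I).carrier := inferInstanceAs (T2Space (I → Y.carrier))
  have hemb : Topology.IsClosedEmbedding E := hE.isClosedEmbedding hinj
  have hmem := @mem_op_of_family _ _ _ _ _ (fun i => (he i).preserves) hinj hop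
  have hs : (Y.power I).OpClosed (Set.range E) := by
    intro n g x hx y hy
    choose x' hx' using hx
    obtain rfl : (fun k => E (x' k)) = x := funext hx'
    obtain ⟨H, rfl⟩ := hy
    obtain ⟨y', hy'⟩ := hop g x' fun i => ⟨_, Part.get_mem (H i)⟩
    refine ⟨y', funext fun i => Part.mem_unique ((he i).map_op g x' y' hy') (Part.get_mem (H i))⟩
  refine ⟨I, hI, Set.range E, hs, hemb.isClosed_range, fun x => ⟨E x, x, rfl⟩, ⟨?_, ?_, ?_⟩, ?_⟩
  · exact hE.subtype_mk _
  · intro n g x y hy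
    exact mem_op_sub_power.2 fun i => (he i).map_op g x y hy
  · intro n r x hx i
    exact (he i).map_rel r x hx
  · let F := hemb.isEmbedding.toHomeomorph
    have hF : ∀ y i, e i (F.symm y) = y.1 i := fun y =>
      congrFun (congrArg Subtype.val (F.apply_symm_apply y))
    refine ⟨F.symm, ⟨F.symm.continuous, ?_, ?_⟩, F.symm_apply_apply, F.apply_symm_apply⟩
    · intro n g x y hy
      refine hmem g _ _ fun i => ?_
      exact (congrArg₂ (fun a b => a ∈ Y.op g b) (hF y i) (funext fun k => hF (x k) i)).mpr
        (mem_op_sub_power.1 hy i)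
    · intro n r x hx
      refine hrel r _ fun i => ?_
      exact (congrArg (fun b => b ∈ Y.rel r) (funext fun k => hF (x k) i)).mpr (hx i)

/-- Members of the topological prevariety of a finite discrete structure are Boolean. -/
theorem InIScP.isBoolean [Finite Y.carrier] [DiscreteTopology Y.carrier] (h : Y.InIScP X) :
    X.IsBoolean := by
  obtain ⟨I, hI, e, he, hemb, hop, hrel⟩ := h.exists_family
  have hmem := @mem_op_of_family _ _ _ _ _ (fun i => (he i).preserves) hemb.injective hop
  refine IsBoolean.of_isClosed_graph hemb.compactSpace hemb.isEmbedding.t2Space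
    (hemb.isEmbedding.isTotallyDisconnected_range.1 ?_) (fun {n} g => ?_) (fun {n} r => ?_)
  · exact isTotallyDisconnected_of_totallyDisconnectedSpace _
  · have : {p : (Fin n → X.carrier) × X.carrier | p.2 ∈ X.op g p.1} =
        ⋂ i, (fun p => (fun k => e i (p.1 k), e i p.2)) ⁻¹'
          {q : (Fin n → Y.carrier) × Y.carrier | q.2 ∈ Y.op g q.1} := by
      ext ⟨x, y⟩
      simp only [Set.mem_iInter]
      exact ⟨fun hy i => (he i).map_op g x y hy, hmem g x y⟩
    rw [this]
    refine isClosed_iInter fun i => (isClosed_discrete _).preimage ?_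
    have := (he i).continuous
    fun_prop
  · have : X.rel r = ⋂ i, (fun x k => e i (x k)) ⁻¹' (Y.rel r) := by
      ext x
      simp only [Set.mem_iInter]
      exact ⟨fun hx i => (he i).map_rel r x hx, hrel r x⟩
    rw [this]
    refine isClosed_iInter fun i => (isClosed_discrete _).preimage ?_
    have := (he i).continuous
    fun_prop

/-- Members of the topological prevariety satisfy the universal Horn theory; the power must be
non-zero for the sentences with conclusion `⊥`. -/
theorem InIScP.models (h : Y.InIScP X) (σ : UHSentence S) (hσ : Y.Models σ) : X.Models σ := by
  obtain ⟨I, ⟨i₀⟩, s, hs, -, φ, hφ, ψ, hψ, h1, -⟩ := h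
  intro a ha
  have h2 : ∀ i, ∃ γ ∈ σ.conclusion, γ.Holds Y (fun k => (φ (a k)).1 i) := fun i =>
    hσ _ fun α hα => ((preserves_apply i).comp hφ.preserves).holds (ha α hα)
  obtain ⟨γ, hγ, -⟩ := h2 i₀
  refine ⟨γ, hγ, ?_⟩
  have h3 : γ.Holds ((Y.power I).sub s hs) (fun k => φ (a k)) := holds_sub_power fun i => by
    obtain ⟨γ', hγ', h4⟩ := h2 i
    obtain rfl : γ' = γ := Option.mem_unique hγ' hγ
    exact h4
  have h4 := hψ.preserves.holds h3
  simpa only [h1 _] using h4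

end TopStr

/-! ### Duals, preduals and the evaluation maps -/

section Algebras

variable {L : FirstOrder.Language.{v, w}} {M : Type u} [L.Structure M]

/-- The homomorphism into a power given by a family of homomorphisms. -/
def piHom {A : Type*} [L.Structure A] [L.IsAlgebraic] {I : Type*} (f : I → A →[L] M) :
    A →[L] (I → M) where
  toFun a i := f i a
  map_fun' g x := funext fun i => (f i).map_fun g x
  map_rel' r := isEmptyElim r

/-- An algebra belongs to `ISP(M)` if its homomorphisms into `M` separate the points. -/
theorem InISP.of_separating [L.IsAlgebraic] {A : Type u} [L.Structure A] [hA : Nonempty A]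
    (h : ∀ a b : A, (∀ f : A →[L] M, f a = f b) → a = b) : InISP L M A := by
  have hinj : Function.Injective (piHom fun f : A →[L] M => f) := fun a b hab =>
    h a b fun f => congrFun hab f
  exact ⟨hA, _, _, ⟨(FirstOrder.Language.Embedding.ofInjective hinj).equivRange⟩⟩

/-- A coordinate projection, restricted to a subalgebra of a power. -/
def coordHom [L.IsAlgebraic] {I : Type*} (A : L.Substructure (I → M)) (i : I) : A →[L] M where
  toFun a := a.1 i
  map_fun' _ _ := rfl
  map_rel' r := isEmptyElim r

theorem InISP.of_substructure [L.IsAlgebraic] {I : Type} {A : L.Substructure (I → M)}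
    (hA : (A : Set (I → M)).Nonempty) : InISP L M A := by
  have : Nonempty A := hA.to_subtype
  exact InISP.of_separating fun a b h => Subtype.ext (funext fun i => h (coordHom A i))

theorem InISP.separating [L.IsAlgebraic] {A : Type u} [L.Structure A] (hA : InISP L M A)
    {a b : A} (h : ∀ f : A →[L] M, f a = f b) : a = b := by
  obtain ⟨-, I, A', ⟨e⟩⟩ := hA
  exact e.injective <| Subtype.ext <| funext fun i => h ((coordHom A' i).comp e.toHom)

end Algebras

namespace AlterEgo

variable {L : FirstOrder.Language.{v, w}} {M : Type u} [L.Structure M] (𝕄 : AlterEgo L M)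

instance : DiscreteTopology 𝕄.str.carrier := ⟨rfl⟩

instance [Finite M] : Finite 𝕄.str.carrier := inferInstanceAs (Finite M)

instance [Nonempty M] : Nonempty 𝕄.str.carrier := inferInstanceAs (Nonempty M)

variable [L.IsAlgebraic]

/-- A homomorphism, as a point of the dual. -/
def pt {A : Type u} [L.Structure A] (f : A →[L] M) : (𝕄.dual A).carrier := ⟨(⇑f : A → M), f, rfl⟩

variable {𝕄}

theorem exists_pt {A : Type u} [L.Structure A] (x : (𝕄.dual A).carrier) :
    ∃ f : A →[L] M, x = 𝕄.pt f := by
  obtain ⟨_, f, rfl⟩ := x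
  exact ⟨f, rfl⟩

theorem mem_op_dual {A : Type u} [L.Structure A] {n : ℕ} {g : 𝕄.sig.Functions n}
    {x : Fin n → (𝕄.dual A).carrier} {y : (𝕄.dual A).carrier} :
    y ∈ (𝕄.dual A).op g x ↔ ∀ a, y.1 a ∈ g.1 (fun k => (x k).1 a) :=
  TopStr.mem_op_sub_power

/-- The dual of a homomorphism. -/
def dualMap {A B : Type u} [L.Structure A] [L.Structure B] (θ : A →[L] B)
    (x : (𝕄.dual B).carrier) : (𝕄.dual A).carrier :=
  ⟨fun a => x.1 (θ a), by
    obtain ⟨f, hf⟩ := x.2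
    exact ⟨f.comp θ, by rw [← hf]; rfl⟩⟩

theorem preserves_dualMap {A B : Type u} [L.Structure A] [L.Structure B] (θ : A →[L] B) :
    TopStr.Preserves (𝕄.dual B) (𝕄.dual A) (dualMap θ) :=
  ⟨fun _ _ _ hy => mem_op_dual.2 fun a => mem_op_dual.1 hy (θ a), fun _ _ hx a => hx (θ a)⟩

theorem isClosed_homs (A : Type u) [L.Structure A] [Finite M] :
    IsClosed (X := A → 𝕄.str.carrier) {x : A → M | ∃ f : A →[L] M, ⇑f = x} := by
  have : {x : A → M | ∃ f : A →[L] M, ⇑f = x} =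
      ⋂ (n : ℕ) (g : L.Functions n) (b : Fin n → A),
        {x : A → M | x (FirstOrder.Language.Structure.funMap g b) =
          FirstOrder.Language.Structure.funMap g (fun k => x (b k))} := by
    ext x
    simp only [Set.mem_iInter]
    constructor
    · rintro ⟨f, rfl⟩ n g b
      exact f.map_fun g b
    · intro h
      exact ⟨⟨x, fun {n} g b => h n g b, fun r => isEmptyElim r⟩, rfl⟩
  refine (congrArg (fun s : Set (A → M) => IsClosed (X := A → 𝕄.str.carrier) s) this).mpr ?_
  refine isClosed_iInter fun n => isClosed_iInter fun g => isClosed_iInter fun b => ?_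
  have h1 : Continuous fun x : A → 𝕄.str.carrier =>
      (x (FirstOrder.Language.Structure.funMap g b), fun k => x (b k)) := by fun_prop
  exact (isClosed_discrete {p : 𝕄.str.carrier × (Fin n → 𝕄.str.carrier) |
    p.1 = FirstOrder.Language.Structure.funMap (M := M) g p.2}).preimage h1

/-- Duals belong to the topological prevariety of the alter ego. -/
theorem inIScP_dual (A : Type u) [L.Structure A] [Finite M] [hA : Nonempty A] :
    𝕄.str.InIScP (𝕄.dual A) :=
  ⟨A, hA, _, _, 𝕄.isClosed_homs A, id,
    ⟨continuous_id, fun _ _ _ h => h, fun _ _ h => h⟩, id,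
    ⟨continuous_id, fun _ _ _ h => h, fun _ _ h => h⟩, fun _ => rfl, fun _ => rfl⟩

theorem EvalStrIso.inIScP [Finite M] {X : TopStr 𝕄.sig} (hX : 𝕄.EvalStrIso X)
    (hE : Nonempty (𝕄.predual X)) : 𝕄.str.InIScP X :=
  ⟨_, hE, _, _, 𝕄.isClosed_homs _, _, hX⟩

theorem evalAlgIso_iff {A : Type u} [L.Structure A] (hA : InISP L M A) :
    𝕄.EvalAlgIso A ↔ ∀ u, TopStr.IsMorphism (𝕄.dual A) 𝕄.str u →
      ∃ a, ∀ x : (𝕄.dual A).carrier, u x = x.1 a := by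
  constructor
  · rintro ⟨g, hg⟩ u hu
    obtain ⟨a, ha⟩ := g.surjective ⟨u, hu⟩
    refine ⟨a, fun x => ?_⟩
    rw [hg] at ha
    exact (congrFun (congrArg Subtype.val ha) x).symm
  · intro h
    let E : A →[L] 𝕄.predual (𝕄.dual A) :=
      { toFun := 𝕄.evalAlg A
        map_fun' := fun g b => Subtype.ext <| funext fun x => by
          obtain ⟨f, rfl⟩ := exists_pt x
          exact f.map_fun g b
        map_rel' := fun r => isEmptyElim r }
    have hbij : Function.Bijective E := by
      refine ⟨fun a b hab => hA.separating fun f => ?_, fun u => ?_⟩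
      · exact congrFun (congrArg Subtype.val hab) (𝕄.pt f)
      · obtain ⟨a, ha⟩ := h u.1 u.2
        exact ⟨a, Subtype.ext <| funext fun x => (ha x).symm⟩
    refine ⟨⟨Equiv.ofBijective E hbij, fun g b => E.map_fun g b, fun r => isEmptyElim r⟩, rfl⟩

/-- Over a compact structure, the evaluation map is an isomorphism if each homomorphism of the
predual is the evaluation at a point, and the morphisms into the alter ego determine the
structure. -/
theorem evalStrIso_of_compact [Finite M] {X : TopStr 𝕄.sig} [CompactSpace X.carrier]
    (hsurj : ∀ α : 𝕄.predual X →[L] M, ∃ x, ∀ u, α u = u.1 x)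
    (hinj : ∀ x y : X.carrier, (∀ u : 𝕄.predual X, u.1 x = u.1 y) → x = y)
    (hop : ∀ {n : ℕ} (g : 𝕄.sig.Functions n) (x : Fin n → X.carrier) (y : X.carrier),
      (∀ u : 𝕄.predual X, u.1 y ∈ g.1 (fun k => u.1 (x k))) → y ∈ X.op g x)
    (hrel : ∀ {n : ℕ} (r : 𝕄.sig.Relations n) (x : Fin n → X.carrier),
      (∀ u : 𝕄.predual X, (fun k => u.1 (x k)) ∈ r.1) → x ∈ X.rel r) : 𝕄.EvalStrIso X := by
  have hc : Continuous (𝕄.evalStr X) :=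
    Continuous.subtype_mk (continuous_pi fun u => u.2.continuous) _
  have hbij : Function.Bijective (𝕄.evalStr X) := by
    refine ⟨fun x y hxy => hinj x y fun u => congrFun (congrArg Subtype.val hxy) u, fun p => ?_⟩
    obtain ⟨α, rfl⟩ := exists_pt p
    obtain ⟨x, hx⟩ := hsurj α
    exact ⟨x, Subtype.ext <| funext fun u => (hx u).symm⟩
  have : T2Space (𝕄.dual (𝕄.predual X)).carrier :=
    inferInstanceAs (T2Space {x : 𝕄.predual X → 𝕄.str.carrier | _})
  let F := hc.homeoOfEquivCompactToT2 (f := Equiv.ofBijective _ hbij)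
  have hF : ∀ p, 𝕄.evalStr X (F.symm p) = p := F.apply_symm_apply
  refine ⟨⟨hc, fun {n} g x y hy => ?_, fun {n} r x hx u => ?_⟩, F.symm,
    ⟨F.symm.continuous, fun {n} g x y hy => ?_, fun {n} r x hx => ?_⟩,
    F.symm_apply_apply, F.apply_symm_apply⟩
  · exact mem_op_dual.2 fun u => u.2.map_op g x y hy
  · exact u.2.map_rel r x hx
  · refine hop g _ _ fun u => ?_
    have h1 := mem_op_dual.1 hy u
    rw [← hF y,
      show x = fun k => 𝕄.evalStr X (F.symm (x k)) from funext fun k => (hF _).symm] at h1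
    exact h1
  · refine hrel r _ fun u => ?_
    have h1 := hx u
    rw [show x = fun k => 𝕄.evalStr X (F.symm (x k)) from funext fun k => (hF _).symm] at h1
    exact h1

theorem EvalStrIso.exists_eval {X : TopStr 𝕄.sig} (hX : 𝕄.EvalStrIso X)
    (α : 𝕄.predual X →[L] M) : ∃ x, ∀ u, α u = u.1 x := by
  obtain ⟨-, ψ, -, -, h⟩ := hX
  exact ⟨ψ (𝕄.pt α), fun u => (congrArg (fun p => p.1 u) (h (𝕄.pt α))).symm⟩

/-- If `𝕄` dualises at the finite level, then the maps on the dual of a subalgebra of a finite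
power that preserve the structure are the evaluations. -/
theorem DualisesFin.exists_eval [Finite M] (h : 𝕄.DualisesFin) {n : ℕ}
    {A : L.Substructure (Fin n → M)} (hA : (A : Set (Fin n → M)).Nonempty)
    {u : (𝕄.dual A).carrier → 𝕄.str.carrier} (hu : TopStr.Preserves (𝕄.dual A) 𝕄.str u) :
    ∃ a : A, ∀ f : A →[L] M, u (𝕄.pt f) = f a := by
  have : Finite A := Subtype.finite
  have : Finite (𝕄.dual A).carrier := Subtype.finite (α := A → M)
  have : DiscreteTopology (𝕄.dual A).carrier :=
    inferInstanceAs (DiscreteTopology {x : A → 𝕄.str.carrier | _})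
  obtain ⟨a, ha⟩ := (evalAlgIso_iff (InISP.of_substructure hA)).1
    (h A inferInstance (InISP.of_substructure hA)) u (hu.isMorphism continuous_of_discreteTopology)
  exact ⟨a, fun f => ha _⟩

end AlterEgo

namespace AlterEgo

variable {L : FirstOrder.Language.{v, w}} {M : Type u} [L.Structure M] {𝕄 𝕄' : AlterEgo L M}

theorem snoc_mem_graphRel {X : Type u} {n : ℕ} {h : (Fin n → M) →. M} (φ : X → M) {x : Fin n → X}
    {y : X} : (fun k => φ ((Fin.snoc x y : Fin (n + 1) → X) k)) ∈ graphRel h ↔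
      φ y ∈ h (fun k => φ (x k)) := by
  change φ _ ∈ h _ ↔ _
  simp

/-! ### Solution sets of atomic formulas, and the terms that represent their homomorphisms -/

theorem termVal_funMap {n m : ℕ} {t : 𝕄.sig.Term (Fin n)} (f : L.Functions m)
    {a : Fin m → Fin n → M} {y : Fin m → M} (h : ∀ k, 𝕄.str.TermVal (a k) t (y k)) :
    𝕄.str.TermVal (FirstOrder.Language.Structure.funMap f a : Fin n → M) t
      (FirstOrder.Language.Structure.funMap f y : M) := by
  induction t generalizing y with
  | var i => exact congrArg _ (funext h)
  | func g ts ih =>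
    choose z hz hy using h
    exact ⟨fun k => FirstOrder.Language.Structure.funMap (M := M) f (fun j => z j k),
      fun k => ih k fun j => hz j k, (𝕄.compat_op g.1 g.2).funMap_mem f _ _ hy⟩

variable (𝕄) in
/-- The assignments in the alter ego that satisfy the given atomic formulas: a subalgebra of a
finite power. -/
def solutions {n : ℕ} (Φ : Set (Atomic 𝕄.sig n)) : L.Substructure (Fin n → M) where
  carrier := {p | ∀ α ∈ Φ, α.Holds 𝕄.str p}
  fun_mem := by
    intro m f a ha α hα
    have h := fun k => ha k α hα
    cases α with
    | eq s t =>
      choose y hs ht using h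
      exact ⟨_, termVal_funMap f hs, termVal_funMap f ht⟩
    | rel r ts =>
      choose z hz hr using h
      exact ⟨fun k => FirstOrder.Language.Structure.funMap (M := M) f (fun j => z j k),
        fun k => termVal_funMap f fun j => hz j k, (𝕄.compat_rel r.1 r.2).funMap_mem f _ hr⟩

/-- The values in `𝕄` of a finite tuple of `X` under all maps that preserve the structure. -/
def trace {X : TopStr 𝕄.sig} {n : ℕ} (a : Fin n → X.carrier) : L.Substructure (Fin n → M) where
  carrier := {p | ∃ φ, TopStr.Preserves X 𝕄.str φ ∧ (fun k => φ (a k)) = p}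
  fun_mem := by
    intro m f p hp
    choose φ hφ hp using hp
    refine ⟨fun x => FirstOrder.Language.Structure.funMap (M := M) f (fun k => φ k x),
      ⟨fun g x y hy => ?_, fun r x hx => ?_⟩, ?_⟩
    · exact (𝕄.compat_op g.1 g.2).funMap_mem f (fun k i => φ k (x i)) (fun k => φ k y)
        (fun k => (hφ k).map_op g x y hy)
    · exact (𝕄.compat_rel r.1 r.2).funMap_mem f (fun k i => φ k (x i))
        (fun k => (hφ k).map_rel r x hx)
    · obtain rfl : (fun k i => φ k (a i)) = p := funext hp
      rfl

theorem trace_nonempty [Finite M] [Nonempty M]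
    {X : TopStr 𝕄.sig} (hX : ∀ σ : UHSentence 𝕄.sig, 𝕄.str.Models σ → X.Models σ) {n : ℕ}
    (a : Fin n → X.carrier) : (trace a : Set (Fin n → M)).Nonempty := by
  obtain ⟨φ, hφ⟩ := TopStr.exists_preserves (Y := 𝕄.str) hX
  exact ⟨_, φ, hφ, rfl⟩

/-! ### Change of the alter ego -/

variable (𝕄') in
/-- The structure `X`, with the partial operations and relations of another alter ego `𝕄'`: they
hold in `X` if they hold under all maps from `X` to `𝕄` that preserve the structure of `𝕄`. -/
noncomputable def transfer (X : TopStr 𝕄.sig) : TopStr 𝕄'.sig where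
  carrier := X.carrier
  top := X.top
  op g x := ⟨∃ y, ∀ φ, TopStr.Preserves X 𝕄.str φ → φ y ∈ g.1 (fun k => φ (x k)),
    fun H => H.choose⟩
  rel r := {x | ∀ φ, TopStr.Preserves X 𝕄.str φ → (fun k => φ (x k)) ∈ r.1}

theorem mem_op_transfer [Finite M] [Nonempty M] {X : TopStr 𝕄.sig}
    (hX : ∀ σ : UHSentence 𝕄.sig, 𝕄.str.Models σ → X.Models σ) {n : ℕ}
    {g : 𝕄'.sig.Functions n} {x : Fin n → X.carrier} {y : X.carrier} :
    y ∈ (transfer 𝕄' X).op g x ↔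
      ∀ φ, TopStr.Preserves X 𝕄.str φ → φ y ∈ g.1 (fun k => φ (x k)) := by
  constructor
  · rintro ⟨H, rfl⟩
    exact H.choose_spec
  · intro h
    have H : ∃ y, ∀ φ, TopStr.Preserves X 𝕄.str φ → φ y ∈ g.1 (fun k => φ (x k)) := ⟨y, h⟩
    exact ⟨H, TopStr.eq_of_forall_preserves (Y := 𝕄.str) hX fun φ hφ =>
      Part.mem_unique (H.choose_spec φ hφ) (h φ hφ)⟩

theorem preserves_transfer [Finite M] [Nonempty M] {X : TopStr 𝕄.sig}
    (hX : ∀ σ : UHSentence 𝕄.sig, 𝕄.str.Models σ → X.Models σ) {φ : X.carrier → 𝕄.str.carrier}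
    (hφ : TopStr.Preserves X 𝕄.str φ) :
    TopStr.Preserves (transfer 𝕄' X) 𝕄'.str φ :=
  ⟨fun _ _ _ hy => (mem_op_transfer hX).1 hy φ hφ, fun _ _ hx => hx φ hφ⟩

variable [L.IsAlgebraic]

/-! ### Fullness at the finite level -/

/-- If `𝕄` is full at the finite level, then a homomorphism from a solution set to `M` is a term
function of `𝕄`: the solution set is the predual of the substructure that the coordinate
projections generate, and the homomorphism is the evaluation at a point of this structure. -/
theorem exists_term_of_full [Finite M]
    (hfull : ∀ X : TopStr 𝕄.sig, Finite X.carrier → 𝕄.str.InIScP X → 𝕄.EvalStrIso X) {n : ℕ}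
    {Φ : Set (Atomic 𝕄.sig n)} (hne : Nonempty (𝕄.solutions Φ)) (f : 𝕄.solutions Φ →[L] M) :
    ∃ t : 𝕄.sig.Term (Fin n), ∀ p : 𝕄.solutions Φ, 𝕄.str.TermVal p.1 t (f p) := by
  let B := 𝕄.solutions Φ
  have : Finite B := Subtype.finite
  let s : Set (𝕄.str.power B).carrier :=
    {y | ∃ t : 𝕄.sig.Term (Fin n), ∀ p : B, 𝕄.str.TermVal p.1 t (y p)}
  have hs : (𝕄.str.power B).OpClosed s := by
    rintro m g x hx y ⟨H, rfl⟩
    choose t ht using hx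
    exact ⟨.func g t, fun p => ⟨fun k => x k p, fun k => ht k p, Part.get_mem (H p)⟩⟩
  let Y := (𝕄.str.power B).sub s hs
  have : Finite (𝕄.str.power B).carrier := inferInstanceAs (Finite (B → M))
  have : Finite Y.carrier := Subtype.finite
  have : T1Space (𝕄.str.power B).carrier := inferInstanceAs (T1Space (B → 𝕄.str.carrier))
  have hY : 𝕄.str.InIScP Y := ⟨B, hne, s, hs, s.toFinite.isClosed, id,
    ⟨continuous_id, fun _ _ _ h => h, fun _ _ h => h⟩, id,
    ⟨continuous_id, fun _ _ _ h => h, fun _ _ h => h⟩, fun _ => rfl, fun _ => rfl⟩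
  let π : Fin n → Y.carrier := fun k => ⟨fun p => p.1 k, .var k, fun _ => rfl⟩
  let θ : 𝕄.predual Y →[L] M :=
    { toFun := fun u => f ⟨fun k => u.1 (π k), fun α hα =>
        u.2.preserves.holds (TopStr.holds_sub_power fun p => p.2 α hα)⟩
      map_fun' := fun g u => f.map_fun g fun j =>
        ⟨fun k => (u j).1 (π k), fun α hα =>
        (u j).2.preserves.holds (TopStr.holds_sub_power fun p => p.2 α hα)⟩
      map_rel' := fun r => isEmptyElim r }
  obtain ⟨y, hy⟩ := (hfull Y inferInstance hY).exists_eval θ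
  obtain ⟨t, ht⟩ := y.2
  refine ⟨t, fun p => ?_⟩
  have h1 := hy ⟨fun x => x.1 p, (TopStr.preserves_apply p).isMorphism
    ((continuous_apply p).comp TopStr.continuous_val_sub_power)⟩
  have h2 : f p = y.1 p := h1
  rw [h2]
  exact ht p

/-- Let `𝕄` be full at the finite level, and let `X` be a model of its universal Horn theory. Then
a finite tuple `a` of `X` is the image of the coordinate projections under a map from the dual of
`trace a` to `X`. Some finite `F ⊆ X` already enforces `trace a`; the points of the dual become
terms in the elements of `F`, and these terms are evaluated in `X`. -/
theorem exists_preserves_dual_trace [Finite M] [Nonempty M]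
    (hfull : ∀ X : TopStr 𝕄.sig, Finite X.carrier → 𝕄.str.InIScP X → 𝕄.EvalStrIso X)
    {X : TopStr 𝕄.sig} (hX : ∀ σ : UHSentence 𝕄.sig, 𝕄.str.Models σ → X.Models σ) {n : ℕ}
    (a : Fin n → X.carrier) :
    ∃ W, TopStr.Preserves (𝕄.dual (trace a)) X W ∧ ∀ k, W (𝕄.pt (coordHom _ k)) = a k := by
  classical
  obtain ⟨F, haF, hF⟩ : ∃ F : Finset X.carrier, (∀ k, a k ∈ F) ∧
      ∀ φ, TopStr.PreservesOn X 𝕄.str F φ → (fun k => φ (a k)) ∈ trace a := by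
    by_contra! hcon
    obtain ⟨φ, h1, h2⟩ := TopStr.exists_preserves_of_forall_finset (Y := 𝕄.str) a
      {p | p ∉ trace a} fun F => by
        obtain ⟨φ, h1, h2⟩ := hcon (F ∪ Finset.univ.image a) (by simp)
        exact ⟨φ, h1.mono (by simp), h2⟩
    exact h2 ⟨φ, h1, rfl⟩
  obtain ⟨m, b, hb, hbF⟩ := TopStr.exists_enum F
  have hab : ∀ k, ∃ i, b i = a k := fun k => by
    rw [← Set.mem_range, hbF]; exact haF k
  choose j hj using hab
  let B := 𝕄.solutions {α | α.Holds X b}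
  have hB : ∀ α : Atomic 𝕄.sig m, (∀ p : B, α.Holds 𝕄.str p.1) → α.Holds X b := by
    intro α hα
    by_contra hn
    obtain ⟨p, hp, hp'⟩ := TopStr.exists_assignment hX b (some α) (by simpa using hn)
    exact hp' α rfl (hα ⟨p, hp⟩)
  have hne : Nonempty B := by
    obtain ⟨p, hp, -⟩ := TopStr.exists_assignment hX b none (by simp)
    exact ⟨p, hp⟩
  have hρ : ∀ p : B, (fun k => p.1 (j k)) ∈ trace a := by
    intro p
    obtain ⟨φ, hφ⟩ := TopStr.exists_extension (Y := 𝕄.str) hb p.1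
    have h1 := hF φ ((TopStr.preservesOn_of_atomic p.2 hφ).mono hbF.ge)
    have h2 : (fun k => φ (a k)) = fun k => p.1 (j k) := funext fun k => by
      rw [← hj k, hφ]
    rwa [h2] at h1
  let ρ : B →[L] trace a :=
    { toFun := fun p => ⟨fun k => p.1 (j k), hρ p⟩
      map_fun' := fun g p => rfl
      map_rel' := fun r => isEmptyElim r }
  have hterm : ∀ x : (𝕄.dual (trace a)).carrier, ∃ t : 𝕄.sig.Term (Fin m),
      ∀ p : B, 𝕄.str.TermVal p.1 t (x.1 (ρ p)) := by
    intro x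
    obtain ⟨f, rfl⟩ := exists_pt x
    exact exists_term_of_full hfull hne (f.comp ρ)
  choose t ht using hterm
  have hval : ∀ x, ∃ y, X.TermVal b (t x) y := fun x => by
    obtain ⟨y, hy, -⟩ := hB (.eq (t x) (t x)) fun p => ⟨_, ht x p, ht x p⟩
    exact ⟨y, hy⟩
  choose W hW using hval
  refine ⟨W, ⟨fun {k} g x y hy => ?_, fun {k} r x hx => ?_⟩, fun k => ?_⟩
  · obtain ⟨z, ⟨q, hq, hz⟩, hz'⟩ := hB (.eq (.func g fun i => t (x i)) (t y)) fun p =>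
      ⟨y.1 (ρ p), ⟨fun i => (x i).1 (ρ p), fun i => ht (x i) p, mem_op_dual.1 hy (ρ p)⟩, ht y p⟩
    obtain rfl : q = fun i => W (x i) := funext fun i => (hq i).unique (hW _)
    obtain rfl : z = W y := hz'.unique (hW _)
    exact hz
  · obtain ⟨q, hq, hz⟩ := hB (.rel r fun i => t (x i)) fun p =>
      ⟨fun i => (x i).1 (ρ p), fun i => ht (x i) p, hx (ρ p)⟩
    obtain rfl : q = fun i => W (x i) := funext fun i => (hq i).unique (hW _)
    exact hz
  · obtain ⟨z, hz, hz'⟩ := hB (.eq (t (𝕄.pt (coordHom _ k))) (.var (j k))) fun p =>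
      ⟨p.1 (j k), ht _ p, rfl⟩
    obtain rfl : z = b (j k) := hz'
    rw [← hj k]
    exact (hW _).unique hz

/-- If `𝕄` dualises at the finite level, then a map from a dual to `𝕄` that preserves the structure
respects all compatible relations, not only those of the signature. -/
theorem DualisesFin.mem_of_preserves [Finite M] (h : 𝕄.DualisesFin) {A : Type u} [L.Structure A]
    {u : (𝕄.dual A).carrier → 𝕄.str.carrier} (hu : TopStr.Preserves (𝕄.dual A) 𝕄.str u) {n : ℕ}
    {r : Set (Fin n → M)} (hr : CompatRel L r) (x : Fin n → (𝕄.dual A).carrier)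
    (hx : ∀ a, (fun k => (x k).1 a) ∈ r) : (fun k => u (x k)) ∈ r := by
  obtain ⟨hne, B, rfl⟩ := hr
  choose f hf using fun k => exists_pt (x k)
  obtain rfl : x = fun k => 𝕄.pt (f k) := funext hf
  let θ : A →[L] B :=
    { toFun := fun a => ⟨fun k => f k a, hx a⟩
      map_fun' := fun g b => Subtype.ext <| funext fun k => (f k).map_fun g b
      map_rel' := fun r => isEmptyElim r }
  obtain ⟨p, hp⟩ := h.exists_eval hne (hu.comp (preserves_dualMap θ))
  have : (fun k => u (𝕄.pt (f k))) = p.1 := funext fun k => hp (coordHom B k)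
  rw [this]
  exact p.2

/-! ### Transfer of standardness and full duality -/

theorem preserves_dual_transfer [Finite M] [Nonempty M] (h : 𝕄.DualisesFin) {X : TopStr 𝕄.sig}
    (hX : ∀ σ : UHSentence 𝕄.sig, 𝕄.str.Models σ → X.Models σ) {A : Type u} [L.Structure A]
    {W : (𝕄.dual A).carrier → X.carrier} (hW : TopStr.Preserves (𝕄.dual A) X W) :
    TopStr.Preserves (𝕄'.dual A) (transfer 𝕄' X) W := by
  refine ⟨fun {n} g x y hy => ?_, fun {n} r x hx => ?_⟩
  · refine (mem_op_transfer hX).2 fun φ hφ => ?_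
    have h1 := h.mem_of_preserves (hφ.comp hW) (𝕄'.compat_op g.1 g.2)
      (Fin.snoc x y : Fin (n + 1) → (𝕄'.dual A).carrier) fun a =>
        (snoc_mem_graphRel fun z : (𝕄'.dual A).carrier => z.1 a).2 (mem_op_dual.1 hy a)
    exact (snoc_mem_graphRel fun z => φ (W z)).1 h1
  · exact fun φ hφ => h.mem_of_preserves (hφ.comp hW) (𝕄'.compat_rel r.1 r.2) x hx

theorem models_transfer [Finite M] [Nonempty M] (h : 𝕄.FullyDualisesFin) {X : TopStr 𝕄.sig}
    (hX : ∀ σ : UHSentence 𝕄.sig, 𝕄.str.Models σ → X.Models σ) (σ : UHSentence 𝕄'.sig)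
    (hσ : 𝕄'.str.Models σ) : (transfer 𝕄' X).Models σ := by
  intro a ha
  change Fin σ.n → X.carrier at a
  have h1 : ∀ p : trace a, ∃ γ ∈ σ.conclusion, γ.Holds 𝕄'.str p.1 := by
    rintro ⟨p, φ, hφ, rfl⟩
    exact hσ _ fun α hα => (preserves_transfer (𝕄' := 𝕄') hX hφ).holds (ha α hα)
  obtain ⟨p₀, hp₀⟩ := trace_nonempty hX a
  obtain ⟨γ, hγ, -⟩ := h1 ⟨p₀, hp₀⟩
  refine ⟨γ, hγ, ?_⟩
  obtain ⟨W, hW, hWa⟩ := exists_preserves_dual_trace h.2 hX a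
  have h2 : γ.Holds (𝕄'.dual (trace a)) (fun k => 𝕄'.pt (coordHom _ k)) :=
    TopStr.holds_sub_power fun p => by
      obtain ⟨γ', hγ', h3⟩ := h1 p
      obtain rfl : γ' = γ := Option.mem_unique hγ' hγ
      exact h3
  have h3 := (preserves_dual_transfer (𝕄' := 𝕄') h.1 hX hW).holds h2
  exact (funext hWa : (fun k => W (𝕄.pt (coordHom _ k))) = a) ▸ h3

/-- For a subalgebra `B` of a finite power, the relation that `B` induces on a Boolean structure
is closed, as the image of a compact set of maps from the dual of `B`. -/
theorem isClosed_induced [Finite M] [Nonempty M] (h : 𝕄.FullyDualisesFin) {X : TopStr 𝕄.sig}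
    (hX : ∀ σ : UHSentence 𝕄.sig, 𝕄.str.Models σ → X.Models σ) (hb : X.IsBoolean) {n : ℕ}
    {r : Set (Fin n → M)} (hr : CompatRel L r) :
    IsClosed {x : Fin n → X.carrier |
      ∀ φ, TopStr.Preserves X 𝕄.str φ → (fun k => φ (x k)) ∈ r} := by
  have := hb.compact
  have := hb.hausdorff
  obtain ⟨B, hB⟩ := hr.2
  have h1 : {x : Fin n → X.carrier |
      ∀ φ, TopStr.Preserves X 𝕄.str φ → (fun k => φ (x k)) ∈ r} =
      (fun (W : (𝕄.dual B).carrier → X.carrier) k => W (𝕄.pt (coordHom B k))) ''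
        {W | TopStr.Preserves (𝕄.dual B) X W} := by
    ext x
    constructor
    · intro hx
      obtain ⟨W, hW, hWx⟩ := exists_preserves_dual_trace h.2 hX x
      have hle : ∀ p : trace x, p.1 ∈ B := by
        rintro ⟨p, φ, hφ, rfl⟩
        have := hx φ hφ
        rwa [← hB] at this
      let ι : trace x →[L] B :=
        { toFun := fun p => ⟨p.1, hle p⟩
          map_fun' := fun _ _ => rfl
          map_rel' := fun r => isEmptyElim r }
      exact ⟨_, hW.comp (preserves_dualMap ι), funext hWx⟩
    · rintro ⟨W, hW, rfl⟩ φ hφ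
      refine h.1.mem_of_preserves (hφ.comp hW) hr _ fun p => ?_
      rw [← hB]
      exact p.2
  have h2 : IsClosed {W | TopStr.Preserves (𝕄.dual B) X W} := by
    have : {W | TopStr.Preserves (𝕄.dual B) X W} =
        (⋂ (n : ℕ) (g : 𝕄.sig.Functions n) (x : Fin n → (𝕄.dual B).carrier)
          (y : (𝕄.dual B).carrier) (_ : y ∈ (𝕄.dual B).op g x),
          (fun W : (𝕄.dual B).carrier → X.carrier => (fun k => W (x k), W y)) ⁻¹'
            {p | p.2 ∈ X.op g p.1}) ∩
        (⋂ (n : ℕ) (r : 𝕄.sig.Relations n) (x : Fin n → (𝕄.dual B).carrier)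
          (_ : x ∈ (𝕄.dual B).rel r),
          (fun (W : (𝕄.dual B).carrier → X.carrier) k => W (x k)) ⁻¹' (X.rel r)) := by
      ext W
      simp only [Set.mem_inter_iff, Set.mem_iInter]
      exact ⟨fun h => ⟨fun n g x y => h.map_op g x y, fun n r x => h.map_rel r x⟩,
        fun h => ⟨fun g x y => h.1 _ g x y, fun r x => h.2 _ r x⟩⟩
    rw [this]
    refine IsClosed.inter ?_ ?_
    · exact isClosed_iInter fun n => isClosed_iInter fun g => isClosed_iInter fun x =>
        isClosed_iInter fun y => isClosed_iInter fun _ =>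
          (hb.isClosed_graph g).preimage (by fun_prop)
    · exact isClosed_iInter fun n => isClosed_iInter fun r => isClosed_iInter fun x =>
        isClosed_iInter fun _ => (hb.closed_rel r).preimage (by fun_prop)
  rw [h1]
  exact (h2.isCompact.image (by fun_prop)).isClosed

theorem isBoolean_transfer [Finite M] [Nonempty M] (h : 𝕄.FullyDualisesFin) {X : TopStr 𝕄.sig}
    (hX : ∀ σ : UHSentence 𝕄.sig, 𝕄.str.Models σ → X.Models σ) (hb : X.IsBoolean) :
    (transfer 𝕄' X).IsBoolean := by
  refine TopStr.IsBoolean.of_isClosed_graph hb.compact hb.hausdorff hb.totallyDisconnected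
    (fun {n} g => ?_) fun {n} r => isClosed_induced h hX hb (𝕄'.compat_rel r.1 r.2)
  have h1 := (isClosed_induced h hX hb (𝕄'.compat_op g.1 g.2)).preimage
    (f := fun p : (Fin n → X.carrier) × X.carrier => (Fin.snoc p.1 p.2 : Fin (n + 1) → X.carrier))
    (Continuous.finSnoc continuous_fst continuous_snd)
  convert! h1 using 1
  ext p
  refine (mem_op_transfer hX).trans (forall₂_congr fun φ _ => (snoc_mem_graphRel φ).symm)

/-- The maps to `𝕄'` that preserve the induced structure also preserve the original one. -/
theorem preserves_of_preserves_transfer [Finite M] [Nonempty M] (h : 𝕄.FullyDualisesFin)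
    (h' : 𝕄'.DualisesFin) {X : TopStr 𝕄.sig}
    (hX : ∀ σ : UHSentence 𝕄.sig, 𝕄.str.Models σ → X.Models σ) {φ : X.carrier → M}
    (hφ : TopStr.Preserves (transfer 𝕄' X) 𝕄'.str φ) : TopStr.Preserves X 𝕄.str φ := by
  have key : ∀ {n : ℕ} (a : Fin n → X.carrier), (fun k => φ (a k)) ∈ trace a := by
    intro n a
    obtain ⟨W, hW, hWa⟩ := exists_preserves_dual_trace h.2 hX a
    obtain ⟨p, hp⟩ := h'.exists_eval (trace_nonempty hX a)
      (hφ.comp (preserves_dual_transfer h.1 hX hW))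
    have : (fun k => φ (a k)) = p.1 := funext fun k => by
      rw [← hWa k]
      exact hp (coordHom _ k)
    rw [this]
    exact p.2
  refine ⟨fun {n} g x y hy => ?_, fun {n} r x hx => ?_⟩
  · obtain ⟨ψ, hψ, he⟩ := key (Fin.snoc x y : Fin (n + 1) → X.carrier)
    have h1 : ∀ k, ψ (x k) = φ (x k) := fun k => by simpa using congrFun he k.castSucc
    have h2 : ψ y = φ y := by simpa using congrFun he (Fin.last n)
    have h3 := hψ.map_op g x y hy
    rw [h2] at h3
    simp only [h1] at h3
    exact h3
  · obtain ⟨ψ, hψ, he⟩ := key x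
    have h3 := hψ.map_rel r x hx
    rw [he] at h3
    exact h3

theorem evalStrIso_of_transfer [Finite M] [Nonempty M] (h : 𝕄.FullyDualisesFin)
    (h' : 𝕄'.DualisesFin) {X : TopStr 𝕄.sig}
    (hX : ∀ σ : UHSentence 𝕄.sig, 𝕄.str.Models σ → X.Models σ) (hb : X.IsBoolean)
    (hX' : 𝕄'.EvalStrIso (transfer 𝕄' X)) : 𝕄.EvalStrIso X := by
  have := hb.compact
  have hE : ∀ u : 𝕄'.predual (transfer 𝕄' X), TopStr.IsMorphism X 𝕄.str u.1 := fun u =>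
    (preserves_of_preserves_transfer h h' hX u.2.preserves).isMorphism u.2.continuous
  have hE' : ∀ u : 𝕄.predual X, TopStr.IsMorphism (transfer 𝕄' X) 𝕄'.str u.1 := fun u =>
    (preserves_transfer (𝕄' := 𝕄') hX u.2.preserves).isMorphism u.2.continuous
  obtain ⟨-, ψ, hψ, hl, -⟩ := id hX'
  -- A compatible relation that holds under all morphisms holds under all maps that preserve the
  -- structure: these maps extend along the inverse `ψ` of the evaluation map.
  have key : ∀ {n : ℕ} {r : Set (Fin n → M)} (_ : CompatRel L r) (x : Fin n → X.carrier),
      (∀ u : 𝕄.predual X, (fun k => u.1 (x k)) ∈ r) →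
      ∀ φ, TopStr.Preserves X 𝕄.str φ → (fun k => φ (x k)) ∈ r := by
    intro n r hr x hx φ hφ
    have h1 := h'.mem_of_preserves ((preserves_transfer (𝕄' := 𝕄') hX hφ).comp hψ.preserves) hr
      (fun k => 𝕄'.evalStr (transfer 𝕄' X) (x k)) fun u => hx ⟨u.1, hE u⟩
    have h2 : (fun k => φ (ψ (𝕄'.evalStr (transfer 𝕄' X) (x k)))) = fun k => φ (x k) :=
      funext fun k => congrArg φ (hl (x k))
    exact h2 ▸ h1
  refine evalStrIso_of_compact (fun α => ?_) (fun x y hxy => ?_) (fun {n} g x y hy => ?_)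
    (fun {n} r x hx => ?_)
  · let ι : 𝕄'.predual (transfer 𝕄' X) →[L] 𝕄.predual X :=
      { toFun := fun u => ⟨u.1, hE u⟩
        map_fun' := fun _ _ => rfl
        map_rel' := fun r => isEmptyElim r }
    obtain ⟨x, hx⟩ := hX'.exists_eval (α.comp ι)
    exact ⟨x, fun u => hx ⟨u.1, hE' u⟩⟩
  · rw [← hl x, ← hl y]
    exact congrArg ψ <| Subtype.ext <| funext fun u => hxy ⟨u.1, hE u⟩
  · refine TopStr.mem_op_of_forall_preserves (Y := 𝕄.str) hX g x y fun φ hφ => ?_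
    have h1 := key (𝕄.compat_op g.1 g.2) (Fin.snoc x y : Fin (n + 1) → X.carrier)
      (fun u => (snoc_mem_graphRel u.1).2 (hy u)) φ hφ
    exact (snoc_mem_graphRel φ).1 h1
  · obtain ⟨q, hq, hr⟩ := TopStr.holds_of_forall_preserves (Y := 𝕄.str) hX x
      (.rel r fun k => .var k)
      fun φ hφ => ⟨_, fun _ => rfl, key (𝕄.compat_rel r.1 r.2) x hx φ hφ⟩
    obtain rfl : q = x := funext hq
    exact hr

/-- A standard fully dualising alter ego passes its properties on to every alter ego that fully
dualises at the finite level. -/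
theorem FullyDualisesFin.isStandard_and_fullyDualises [Finite M] [Nonempty M]
    (h : 𝕄.FullyDualisesFin) (hs' : 𝕄'.IsStandard) (hf' : 𝕄'.FullyDualises) :
    𝕄.IsStandard ∧ 𝕄.FullyDualises := by
  have hfin' : 𝕄'.DualisesFin := fun A _ _ hA => hf'.1 A hA
  have key : ∀ X : TopStr 𝕄.sig, X.IsBoolean →
      (∀ σ : UHSentence 𝕄.sig, 𝕄.str.Models σ → X.Models σ) →
      𝕄.EvalStrIso X ∧ 𝕄.str.InIScP X := by
    intro X hb hX
    have h1 : 𝕄'.str.InIScP (transfer 𝕄' X) :=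
      (hs' _).2 ⟨isBoolean_transfer h hX hb, models_transfer h hX⟩
    have h2 := evalStrIso_of_transfer h hfin' hX hb (hf'.2 _ h1)
    obtain ⟨I, ⟨i⟩, e, he, -⟩ := h1.exists_family
    exact ⟨h2, h2.inIScP ⟨⟨e i, (preserves_of_preserves_transfer h hfin' hX
      (he i).preserves).isMorphism (he i).continuous⟩⟩⟩
  refine ⟨fun X => ⟨fun hX => ⟨hX.isBoolean, hX.models⟩, fun hX => (key X hX.1 hX.2).2⟩,
    fun A _ hA => ?_, fun X hX => (key X hX.isBoolean hX.models).1⟩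
  refine (evalAlgIso_iff hA).2 fun u hu => ?_
  refine (evalAlgIso_iff hA).1 (hf'.1 A hA) u
    ⟨hu.continuous, fun {n} g x y hy => ?_, fun {n} r x hx => ?_⟩
  · have h1 := h.1.mem_of_preserves hu.preserves (𝕄'.compat_op g.1 g.2)
      (Fin.snoc x y : Fin (n + 1) → (𝕄.dual A).carrier) fun a =>
        (snoc_mem_graphRel fun z : (𝕄.dual A).carrier => z.1 a).2 (mem_op_dual.1 hy a)
    exact (snoc_mem_graphRel u).1 h1
  · exact h.1.mem_of_preserves hu.preserves (𝕄'.compat_rel r.1 r.2) x hx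

end AlterEgo

/-! ### Partial actions on Boolean spaces -/

section PartialAction

variable {X M ι : Type*} [TopologicalSpace X]

/-- The elements of `M` on which every partial map that is defined at `x` is defined. -/
def stalk (a : ι → X → X → Prop) (b : ι → M → M → Prop) (x : X) : Set M :=
  {m | ∀ i y, a i x y → ∃ n, b i m n}

/-- Two partial actions of the same set `ι` of partial bijections, on a space `X` (by graphs `a`)
and on a set `M` (by graphs `b`). Composites and inverses are again in `ι`, where composites with
empty domain on `M` are also empty on `X`; and what is defined or equal at `x` is determined by what
is defined or equal on the (non-empty) stalk of `x`. -/
structure IsPartialAction (a : ι → X → X → Prop) (b : ι → M → M → Prop) : Prop where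
  closed : ∀ i, IsClosed {p : X × X | a i p.1 p.2}
  unique : ∀ {i x y y'}, a i x y → a i x y' → y = y'
  unique' : ∀ {i m n n'}, b i m n → b i m n' → n = n'
  one : ∃ i, (∀ x, a i x x) ∧ ∀ m n, b i m n → m = n
  comp : ∀ {i j x y z}, a i x y → a j y z →
    ∃ k, a k x z ∧ ∀ m n, b k m n → ∃ l, b i m l ∧ b j l n
  inv : ∀ i, ∃ j, (∀ x y, a i x y ↔ a j y x) ∧ ∀ m n, b i m n ↔ b j n m
  stalk_nonempty : ∀ x, (stalk a b x).Nonempty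
  dom : ∀ {i x}, (∀ m ∈ stalk a b x, ∃ n, b i m n) → ∃ y, a i x y
  eq : ∀ {i j x y m n n'}, a i x y → a j x y → m ∈ stalk a b x → b i m n → b j m n' → n = n'

/-- `s` is closed under a family of partial maps. -/
def Invariant (a : ι → X → X → Prop) (s : Set X) : Prop :=
  ∀ i x y, x ∈ s → a i x y → y ∈ s

/-- `u` commutes with the partial maps at the points of `s`. -/
def IsEquivariantOn (a : ι → X → X → Prop) (b : ι → M → M → Prop) (s : Set X) (u : X → M) : Prop :=
  ∀ i x y, x ∈ s → a i x y → b i (u x) (u y)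

/-- The points of `Z` at which `u` is equivariant. -/
def goodSet (a : ι → X → X → Prop) (b : ι → M → M → Prop) (Z : Set X) (u : X → M) :
    Set X := {z | z ∈ Z ∧ ∀ i y, a i z y → b i (u z) (u y)}

/-- A continuous map from a closed subset of a Boolean space to a finite discrete space extends. -/
theorem exists_continuous_eqOn [CompactSpace X] [T2Space X] [TotallyDisconnectedSpace X]
    [TopologicalSpace M] [DiscreteTopology M] [Finite M] [Nonempty M]
    {Y : Set X} (hY : IsClosed Y) {u : X → M} (hu : ContinuousOn u Y) :
    ∃ v : X → M, Continuous v ∧ Set.EqOn v u Y := by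
  obtain ⟨C, hC, hYC, -, hcov, hdisj⟩ := exists_clopen_partition_of_clopen_cover
    (Z := fun m => Y ∩ u ⁻¹' {m}) (D := fun _ : M => Set.univ)
    (fun m => hu.preimage_isClosed_of_isClosed hY isClosed_singleton) (fun _ => isClopen_univ)
    (fun _ => Set.subset_univ _)
    (fun m _ n _ hmn => Set.disjoint_left.2 fun x hx hx' => hmn (hx.2.symm.trans hx'.2))
  have h1 : ∀ x, ∃ m, x ∈ C m := fun x => by
    simpa using hcov (Set.mem_iUnion.2 ⟨Classical.arbitrary M, Set.mem_univ x⟩)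
  choose v hv using h1
  have h2 : ∀ {x m}, x ∈ C m → v x = m := fun {x m} hx => by
    by_contra hne
    exact Set.disjoint_left.1 (hdisj (Set.mem_univ _) (Set.mem_univ _) hne) (hv x) hx
  refine ⟨v, ?_, fun x hx => h2 (hYC (u x) ⟨hx, rfl⟩)⟩
  rw [continuous_discrete_rng]
  intro m
  have : v ⁻¹' {m} = C m := by
    ext x
    exact ⟨fun hx => hx ▸ hv x, h2⟩
  rw [this]
  exact (hC m).isOpen

namespace IsPartialAction

variable {a : ι → X → X → Prop} {b : ι → M → M → Prop}

theorem ncard_stalk_le [Finite M] (H : IsPartialAction a b) {i : ι} {x y : X} (h : a i x y) :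
    (stalk a b x).ncard ≤ (stalk a b y).ncard := by
  choose! f hf using fun (m : M) (hm : m ∈ stalk a b x) => hm i y h
  obtain ⟨j, -, hj⟩ := H.inv i
  refine Set.ncard_le_ncard_of_injOn f (fun m hm j z hz => ?_) (fun m hm m' hm' he => ?_)
  · obtain ⟨k, hk, hb⟩ := H.comp h hz
    obtain ⟨n, hn⟩ := hm k z hk
    obtain ⟨l, h1, h2⟩ := hb m n hn
    obtain rfl := H.unique' (hf m hm) h1
    exact ⟨n, h2⟩
  · have h1 := (hj _ _).1 (hf m hm)
    rw [he] at h1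
    exact H.unique' h1 ((hj _ _).1 (hf m' hm'))

theorem ncard_stalk_eq [Finite M] (H : IsPartialAction a b) {i : ι} {x y : X} (h : a i x y) :
    (stalk a b x).ncard = (stalk a b y).ncard := by
  obtain ⟨j, hj, -⟩ := H.inv i
  exact (H.ncard_stalk_le h).antisymm (H.ncard_stalk_le ((hj x y).1 h))

theorem not_mem_of_invariant (H : IsPartialAction a b) {s : Set X} (hs : Invariant a s) {i : ι}
    {x y : X} (h : a i x y) (hx : x ∉ s) : y ∉ s := by
  obtain ⟨j, hj, -⟩ := H.inv i
  exact fun hy => hx (hs j y x hy ((hj x y).1 h))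

/-- Near `z` no partial map is defined that is not defined at `z`. -/
theorem eventually_dom [CompactSpace X] [Finite ι] (H : IsPartialAction a b) (z : X) :
    ∀ᶠ x in nhds z, ∀ i, (∃ y, a i x y) → ∃ y, a i z y := by
  rw [Filter.eventually_all]
  intro i
  have h1 : IsClosed {x | ∃ y, a i x y} := by
    have : {x | ∃ y, a i x y} = Prod.fst '' {p : X × X | a i p.1 p.2} := by
      ext x; simp
    rw [this]
    exact isClosedMap_fst_of_compactSpace _ (H.closed i)
  by_cases hz : ∃ y, a i z y
  · exact Filter.Eventually.of_forall fun _ _ => hz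
  · filter_upwards [h1.isOpen_compl.mem_nhds hz] with x hx hx'
    exact absurd hx' hx

theorem eventually_stalk [CompactSpace X] [Finite ι] (H : IsPartialAction a b) (z : X) :
    ∀ᶠ x in nhds z, stalk a b z ⊆ stalk a b x := by
  filter_upwards [H.eventually_dom z] with x hx m hm i y hy
  obtain ⟨y', hy'⟩ := hx i ⟨y, hy⟩
  exact hm i y' hy'

theorem isClosed_ncard_stalk_le [CompactSpace X] [Finite ι] [Finite M]
    (H : IsPartialAction a b) (k : ℕ) :
    IsClosed {x | (stalk a b x).ncard ≤ k} := by
  rw [← isOpen_compl_iff, isOpen_iff_mem_nhds]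
  intro z hz
  filter_upwards [H.eventually_stalk z] with x hx hx'
  exact hz ((Set.ncard_le_ncard hx).trans hx')

/-- An equivariant map extends to the orbit of a point `z`, with any value from the stalk at `z`. -/
theorem exists_extend_orbit [T2Space X] [TopologicalSpace M] [Finite ι]
    (H : IsPartialAction a b) {Y : Set X} (hY : IsClosed Y)
    (hYi : Invariant a Y) {u : X → M} (hu : ContinuousOn u Y) (hue : IsEquivariantOn a b Y u)
    {z : X} (hz : z ∉ Y) {m : M} (hm : m ∈ stalk a b z) :
    ∃ (Y' : Set X) (u' : X → M), IsClosed Y' ∧ Invariant a Y' ∧ Y ⊆ Y' ∧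
      ContinuousOn u' Y' ∧ IsEquivariantOn a b Y' u' ∧ Set.EqOn u' u Y ∧
      (∀ x ∈ Y', x ∈ Y ∨ ∃ i, a i z x) ∧ (∀ i x n, a i z x → x ∈ Y' ∧ (b i m n → u' x = n)) ∧
      u' z = m := by
  classical
  let O : Set X := {x | ∃ i, a i z x}
  have hOY : ∀ x ∈ O, x ∉ Y := fun x ⟨i, hi⟩ => H.not_mem_of_invariant hYi hi hz
  have hO : O.Finite := by
    have : O = ⋃ i, {x | a i z x} := by ext; simp [O]
    rw [this]
    exact Set.finite_iUnion fun i => Set.Subsingleton.finite fun x hx y hy => H.unique hx hy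
  let u' : X → M := fun x => if x ∈ Y then u x else
    if h : ∃ n i, a i z x ∧ b i m n then h.choose else u x
  have hu'Y : Set.EqOn u' u Y := fun x hx => if_pos hx
  have hu'O : ∀ i x n, a i z x → b i m n → u' x = n := by
    intro i x n hi hn
    have h : ∃ n i, a i z x ∧ b i m n := ⟨n, i, hi, hn⟩
    have h1 : u' x = h.choose := (if_neg (hOY x ⟨i, hi⟩)).trans (dif_pos h)
    obtain ⟨j, hj, hj'⟩ := h.choose_spec
    rw [h1]
    exact H.eq hj hi hm hj' hn
  refine ⟨Y ∪ O, u', hY.union hO.isClosed, ?_, Set.subset_union_left, ?_, ?_, hu'Y,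
    fun x hx => hx, fun i x n hi => ⟨Or.inr ⟨i, hi⟩, hu'O i x n hi⟩, ?_⟩
  · rintro i x y (hx | ⟨j, hj⟩) hxy
    · exact Or.inl (hYi i x y hx hxy)
    · obtain ⟨k, hk, -⟩ := H.comp hj hxy
      exact Or.inr ⟨k, hk⟩
  · exact (hu.congr hu'Y).union_of_isClosed (hO.continuousOn u') hY hO.isClosed
  · rintro i x y (hx | ⟨j, hj⟩) hxy
    · rw [hu'Y hx, hu'Y (hYi i x y hx hxy)]
      exact hue i x y hx hxy
    · obtain ⟨k, hk, hb⟩ := H.comp hj hxy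
      obtain ⟨n, hn⟩ := hm k y hk
      obtain ⟨l, h1, h2⟩ := hb m n hn
      rw [hu'O j x l hj h1, hu'O k y n hk hn]
      exact h2
  · obtain ⟨i, h1, h2⟩ := H.one
    obtain ⟨n, hn⟩ := hm i z (h1 z)
    rw [hu'O i z n (h1 z) hn, h2 m n hn]

theorem invariant_goodSet (H : IsPartialAction a b) {Z : Set X} (hZi : Invariant a Z)
    (u : X → M) : Invariant a (goodSet a b Z u) := by
  rintro i x y ⟨hx, hx'⟩ hxy
  refine ⟨hZi i x y hx hxy, fun j z hz => ?_⟩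
  obtain ⟨k, hk, hb⟩ := H.comp hxy hz
  obtain ⟨l, h1, h2⟩ := hb _ _ (hx' k z hk)
  obtain rfl := H.unique' h1 (hx' i y hxy)
  exact h2

/-- Failure of equivariance is a closed condition, as the graphs are closed. -/
theorem isClosed_diff_goodSet [CompactSpace X] [TopologicalSpace M] [DiscreteTopology M]
    [Finite ι] (H : IsPartialAction a b) {Z : Set X} (hZ : IsClosed Z)
    {u : X → M} (hu : Continuous u) : IsClosed (Z \ goodSet a b Z u) := by
  have h1 : Z \ goodSet a b Z u =
      Z ∩ ⋃ i, Prod.fst '' ({p : X × X | a i p.1 p.2} ∩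
        (fun p => (u p.1, u p.2)) ⁻¹' {q : M × M | ¬ b i q.1 q.2}) := by
    ext z
    simp [goodSet]
  rw [h1]
  refine hZ.inter (isClosed_iUnion_of_finite fun i => isClosedMap_fst_of_compactSpace _ ?_)
  exact (H.closed i).inter ((isClosed_discrete _).preimage (by fun_prop))

/-- If the stalks of the points of `Z \ Y` all have the same size, then the partial maps defined at
such a point do not change nearby, and equivariance is also a closed condition. -/
theorem isClosed_goodSet [CompactSpace X] [TopologicalSpace M] [DiscreteTopology M] [Finite ι]
    [Finite M] (H : IsPartialAction a b) {Y Z : Set X} (hY : IsClosed Y)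
    (hZ : IsClosed Z)
    (hcard : ∀ x ∈ Z \ Y, ∀ y ∈ Z \ Y, (stalk a b x).ncard = (stalk a b y).ncard)
    {u : X → M} (hu : Continuous u) (hYu : Y ⊆ goodSet a b Z u) :
    IsClosed (goodSet a b Z u) := by
  refine isClosed_of_closure_subset fun z hz => ?_
  have hzZ : z ∈ Z := hZ.closure_subset_iff.2 (fun x hx => hx.1) hz
  by_cases hzY : z ∈ Y
  · exact hYu hzY
  refine ⟨hzZ, fun i y hy => ?_⟩
  have hG : IsClosed {x | ∃ y, a i x y ∧ b i (u x) (u y)} := by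
    have : {x | ∃ y, a i x y ∧ b i (u x) (u y)} = Prod.fst '' ({p : X × X | a i p.1 p.2} ∩
        (fun p => (u p.1, u p.2)) ⁻¹' {q : M × M | b i q.1 q.2}) := by
      ext x; simp
    rw [this]
    exact isClosedMap_fst_of_compactSpace _
      ((H.closed i).inter ((isClosed_discrete _).preimage (by fun_prop)))
  have h1 : z ∈ {x | ∃ y, a i x y ∧ b i (u x) (u y)} := by
    rw [← hG.closure_eq]
    rw [mem_closure_iff_frequently] at hz ⊢
    refine (hz.and_eventually ((H.eventually_stalk z).and
      (hY.isOpen_compl.mem_nhds hzY))).mono ?_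
    rintro x ⟨⟨hxZ, hx⟩, hst, hxY⟩
    have hst' : stalk a b z = stalk a b x :=
      Set.eq_of_subset_of_ncard_le hst (hcard x ⟨hxZ, hxY⟩ z ⟨hzZ, hzY⟩).le
    obtain ⟨y', hy'⟩ := H.dom (i := i) (x := x) fun m hm => by
      rw [← hst'] at hm
      exact hm i y hy
    exact ⟨y', hy', hx i y' hy'⟩
  obtain ⟨y', hy', hb⟩ := h1
  obtain rfl := H.unique hy hy'
  exact hb

/-- One stratum of the extension theorem. Locally an equivariant map is obtained from any continuous
extension, on the clopen set where the latter happens to be equivariant. -/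
theorem exists_extend_stratum [CompactSpace X] [T2Space X] [TotallyDisconnectedSpace X]
    [TopologicalSpace M] [DiscreteTopology M] [Finite ι] [Finite M] [Nonempty M]
    (H : IsPartialAction a b) {Y Z : Set X} (hY : IsClosed Y) (hYi : Invariant a Y)
    (hZ : IsClosed Z) (hZi : Invariant a Z)
    (hYZ : Y ⊆ Z)
    (hcard : ∀ x ∈ Z \ Y, ∀ y ∈ Z \ Y, (stalk a b x).ncard = (stalk a b y).ncard)
    {u : X → M} (hu : ContinuousOn u Y) (hue : IsEquivariantOn a b Y u) :
    ∃ v : X → M, ContinuousOn v Z ∧ IsEquivariantOn a b Z v ∧ Set.EqOn v u Y := by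
  classical
  -- `P s`: there is an equivariant map on some set `V ⊇ s`, clopen in `Z` and invariant.
  let P : Set X → Prop := fun s => ∃ V : Set X, Y ⊆ V ∧ s ∩ Z ⊆ V ∧ V ⊆ Z ∧ IsClosed V ∧
    IsClosed (Z \ V) ∧ Invariant a V ∧ ∃ v : X → M, ContinuousOn v Z ∧
      IsEquivariantOn a b V v ∧ Set.EqOn v u Y
  have key : ∀ {Y' : Set X} {u' : X → M}, IsClosed Y' → Y ⊆ Y' → Y' ⊆ Z → Invariant a Y' →
      ContinuousOn u' Y' → IsEquivariantOn a b Y' u' → Set.EqOn u' u Y →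
      ∃ V, Y' ⊆ V ∧ V ⊆ Z ∧ IsClosed (Z \ V) ∧ P V := by
    intro Y' u' hY' hYY' hY'Z hY'i hu' hu'e he
    obtain ⟨v, hv, hvu⟩ := exists_continuous_eqOn hY' hu'
    have hg : Y' ⊆ goodSet a b Z v := fun x hx => ⟨hY'Z hx, fun i y hxy => by
      rw [hvu hx, hvu (hY'i i x y hx hxy)]
      exact hu'e i x y hx hxy⟩
    refine ⟨goodSet a b Z v, hg, fun x hx => hx.1, H.isClosed_diff_goodSet hZ hv,
      goodSet a b Z v, hYY'.trans hg, Set.inter_subset_left, fun x hx => hx.1,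
      H.isClosed_goodSet hY hZ hcard hv (hYY'.trans hg), H.isClosed_diff_goodSet hZ hv,
      H.invariant_goodSet hZi v, v, hv.continuousOn, fun i x y hx hxy => hx.2 i y hxy,
      (hvu.mono hYY').trans he⟩
  have hP : P Z := by
    refine hZ.isCompact.induction_on ?_ ?_ ?_ ?_
    · obtain ⟨V, -, -, -, V', h1, -, h2⟩ := key hY subset_rfl hYZ hYi hu hue fun _ _ => rfl
      exact ⟨V', h1, by simp, h2⟩
    · rintro s t hst ⟨V, h1, h2, h3⟩
      exact ⟨V, h1, (Set.inter_subset_inter_left Z hst).trans h2, h3⟩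
    · rintro s t ⟨V, hV1, hV2, hV3, hV4, hV5, hV6, v, hv1, hv2, hv3⟩
        ⟨W, hW1, hW2, hW3, hW4, hW5, hW6, w, hw1, hw2, hw3⟩
      refine ⟨V ∪ W, hV1.trans Set.subset_union_left, ?_, Set.union_subset hV3 hW3, hV4.union hW4,
        ?_, ?_, fun x => if x ∈ V then v x else w x, ?_, ?_, ?_⟩
      · rintro x ⟨hx | hx, hxZ⟩
        · exact Or.inl (hV2 ⟨hx, hxZ⟩)
        · exact Or.inr (hW2 ⟨hx, hxZ⟩)
      · rw [← Set.sdiff_inter_sdiff]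
        exact hV5.inter hW5
      · rintro i x y (hx | hx) hxy
        · exact Or.inl (hV6 i x y hx hxy)
        · exact Or.inr (hW6 i x y hx hxy)
      · have h1 : ContinuousOn (fun x => if x ∈ V then v x else w x) V :=
          (hv1.mono hV3).congr fun x hx => if_pos hx
        have h2 : ContinuousOn (fun x => if x ∈ V then v x else w x) (Z \ V) :=
          (hw1.mono Set.sdiff_subset).congr fun x hx => if_neg hx.2
        exact (h1.union_of_isClosed h2 hV4 hV5).mono fun x hx => by
          by_cases hxV : x ∈ V
          · exact Or.inl hxV
          · exact Or.inr ⟨hx, hxV⟩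
      · intro i x y hx hxy
        by_cases hxV : x ∈ V
        · simp only [if_pos hxV, if_pos (hV6 i x y hxV hxy)]
          exact hv2 i x y hxV hxy
        · simp only [if_neg hxV, if_neg (H.not_mem_of_invariant hV6 hxy hxV)]
          exact hw2 i x y (hx.resolve_left hxV) hxy
      · intro x hx
        simp only [if_pos (hV1 hx)]
        exact hv3 hx
    · intro z hz
      obtain ⟨V, hzV, hVZ, hVc, hPV⟩ : ∃ V, z ∈ V ∧ V ⊆ Z ∧ IsClosed (Z \ V) ∧ P V := by
        by_cases hzY : z ∈ Y
        · obtain ⟨V, h1, h2⟩ := key hY subset_rfl hYZ hYi hu hue fun _ _ => rfl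
          exact ⟨V, h1 hzY, h2⟩
        · obtain ⟨m, hm⟩ := H.stalk_nonempty z
          obtain ⟨Y', u', h1, h2, h3, h4, h5, h6, h7, h8, -⟩ :=
            H.exists_extend_orbit hY hYi hu hue hzY hm
          obtain ⟨i, hi, -⟩ := H.one
          obtain ⟨V, h9, h10⟩ := key h1 h3 (fun x hx => (h7 x hx).elim (fun h => hYZ h)
            fun ⟨j, hj⟩ => hZi j z x hz hj) h2 h4 h5 h6
          exact ⟨V, h9 (h8 i z m (hi z)).1, h10⟩
      refine ⟨V, ?_, hPV⟩
      rw [mem_nhdsWithin]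
      refine ⟨(Z \ V)ᶜ, hVc.isOpen_compl, fun h => h.2 hzV, fun x ⟨hx, hxZ⟩ => ?_⟩
      by_contra hxV
      exact hx ⟨hxZ, hxV⟩
  obtain ⟨V, -, hV, -, -, -, -, v, h1, h2, h3⟩ := hP
  exact ⟨v, h1, fun i x y hx => h2 i x y (hV ⟨hx, hx⟩), h3⟩

/-- Continuous equivariant maps extend from closed invariant sets: extend to the points with stalk
of size at most `k`, by induction on `k`. -/
theorem exists_extend [CompactSpace X] [T2Space X] [TotallyDisconnectedSpace X]
    [TopologicalSpace M] [DiscreteTopology M] [Finite ι] [Finite M] [Nonempty M]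
    (H : IsPartialAction a b) {Y : Set X} (hY : IsClosed Y) (hYi : Invariant a Y) {u : X → M}
    (hu : ContinuousOn u Y) (hue : IsEquivariantOn a b Y u) :
    ∃ v : X → M, Continuous v ∧ IsEquivariantOn a b Set.univ v ∧ Set.EqOn v u Y := by
  let Z : ℕ → Set X := fun k => Y ∪ {x | (stalk a b x).ncard ≤ k}
  have hZ : ∀ k, IsClosed (Z k) := fun k => hY.union (H.isClosed_ncard_stalk_le k)
  have hZi : ∀ k, Invariant a (Z k) := by
    rintro k i x y (hx | hx) hxy
    · exact Or.inl (hYi i x y hx hxy)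
    · exact Or.inr ((H.ncard_stalk_eq hxy).symm.le.trans hx)
  have key : ∀ k, ∃ v : X → M, ContinuousOn v (Z k) ∧ IsEquivariantOn a b (Z k) v ∧
      Set.EqOn v u Y := by
    intro k
    induction k with
    | zero =>
      have : Z 0 = Y := by
        refine Set.union_eq_self_of_subset_right fun x hx => ?_
        have h1 := (Set.ncard_pos (Set.toFinite _)).2 (H.stalk_nonempty x)
        exact absurd hx (by simp; omega)
      exact ⟨u, this ▸ hu, this ▸ hue, fun _ _ => rfl⟩
    | succ k ih =>
      obtain ⟨v, h1, h2, h3⟩ := ih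
      obtain ⟨w, h4, h5, h6⟩ := H.exists_extend_stratum (hZ k) (hZi k) (hZ (k + 1)) (hZi (k + 1))
        (Set.union_subset_union_right Y fun x (hx : _ ≤ k) => hx.trans k.le_succ) (by
          have : ∀ x ∈ Z (k + 1) \ Z k, (stalk a b x).ncard = k + 1 := by
            rintro x ⟨hx | hx, hx'⟩
            · exact absurd (Or.inl hx) hx'
            · have h7 : ¬ (stalk a b x).ncard ≤ k := fun h => hx' (Or.inr h)
              have h8 : (stalk a b x).ncard ≤ k + 1 := hx
              omega
          intro x hx y hy
          rw [this x hx, this y hy]) h1 h2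
      exact ⟨w, h4, h5, (h6.mono Set.subset_union_left).trans h3⟩
  obtain ⟨v, h1, h2, h3⟩ := key (Nat.card M)
  have : Z (Nat.card M) = Set.univ := Set.eq_univ_of_forall fun x => Or.inr (Set.ncard_le_card _)
  rw [this] at h1 h2
  exact ⟨v, continuousOn_univ.1 h1, h2, h3⟩

end IsPartialAction

end PartialAction

/-! ### The alter ego of compatible partial bijections -/

open FirstOrder.Language.Structure (funMap)

instance {α β : Type*} [Finite α] [Finite β] : Finite (α →. β) :=
  have : Finite (Part β) := Finite.of_equiv _ Part.equivOption.symm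
  inferInstanceAs (Finite (α → Part β))

variable (L : FirstOrder.Language.{v, w}) (M : Type u) [L.Structure M]

/-- The alter ego formed by the compatible nullary operations and the compatible injective unary
partial operations, without relations. The nullary operations are needed already because
the empty structure has to be excluded if `M` has a one-element subalgebra. -/
def partialIsos : AlterEgo L M where
  H n := {h : (Fin n → M) →. M | n ≤ 1 ∧ CompatOp L h ∧ ∀ x x' y, y ∈ h x → y ∈ h x' → x = x'}
  R _ := ∅
  compat_op _ hh := hh.2.1
  compat_rel _ hr := hr.elim

namespace partialIsos

/-- The graph of a unary symbol on `M`. -/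
def graphOn (i : (partialIsos L M).sig.Functions 1) (m n : M) : Prop := n ∈ i.1 (fun _ => m)

variable {L M}

/-- The graph of a unary symbol on a structure. -/
def graphIn (X : TopStr (partialIsos L M).sig) (i : (partialIsos L M).sig.Functions 1)
    (x y : X.carrier) : Prop := y ∈ X.op i (fun _ => x)

instance [Finite M] : Finite ((partialIsos L M).sig.Functions 1) :=
  inferInstanceAs (Finite ((partialIsos L M).H 1))

theorem graphOn_injective {i : (partialIsos L M).sig.Functions 1} {m m' n : M}
    (h : graphOn L M i m n) (h' : graphOn L M i m' n) : m = m' :=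
  congrFun (i.2.2.2 _ _ _ h h') 0

theorem graphOn_functional {i : (partialIsos L M).sig.Functions 1} {m n n' : M}
    (h : graphOn L M i m n) (h' : graphOn L M i m n') : n = n' :=
  Part.mem_unique h h'

theorem graphOn_funMap {i : (partialIsos L M).sig.Functions 1} {k : ℕ} (f : L.Functions k)
    {x y : Fin k → M} (h : ∀ j, graphOn L M i (x j) (y j)) :
    graphOn L M i (funMap f x) (funMap f y) :=
  i.2.2.1.funMap_mem f _ y h

/-- A non-empty compatible graph of a partial bijection is a symbol of the signature. -/
theorem exists_graphOn_iff [L.IsAlgebraic] {ρ : M → M → Prop} (hne : ∃ m n, ρ m n)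
    (hfun : ∀ m n n', ρ m n → ρ m n' → n = n') (hinj : ∀ m m' n, ρ m n → ρ m' n → m = m')
    (hsub : ∀ {k : ℕ} (f : L.Functions k) (x y : Fin k → M), (∀ j, ρ (x j) (y j)) →
      ρ (funMap f x) (funMap f y)) :
    ∃ i, ∀ m n, graphOn L M i m n ↔ ρ m n := by
  let h : (Fin 1 → M) →. M := fun x => ⟨∃ n, ρ (x 0) n, fun H => H.choose⟩
  have hh : ∀ {x n}, n ∈ h x ↔ ρ (x 0) n := by
    intro x n
    constructor
    · rintro ⟨H, rfl⟩
      exact H.choose_spec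
    · intro hn
      have H : ∃ n, ρ (x 0) n := ⟨n, hn⟩
      exact ⟨H, hfun _ _ _ H.choose_spec hn⟩
  refine ⟨⟨h, le_rfl, ⟨?_, ?_⟩, ?_⟩, fun m n => hh (x := fun _ => m)⟩
  · obtain ⟨m, n, hmn⟩ := hne
    exact ⟨![m, n], (hh (x := fun _ => m)).2 hmn⟩
  · refine ⟨⟨graphRel h, fun {k} f x hx =>
      (hh (x := fun _ => funMap f fun j => x j 0)).2 ?_⟩, rfl⟩
    exact hsub f (fun j => x j 0) (fun j => x j 1) fun j =>
      (hh (x := fun _ => x j 0)).1 (hx j)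
  · intro x x' y hx hx'
    funext j
    rw [Subsingleton.elim j 0]
    exact hinj _ _ _ (hh.1 hx) (hh.1 hx')

theorem graphOn_of_preserves {X : TopStr (partialIsos L M).sig} {φ : X.carrier → M}
    (hφ : TopStr.Preserves X (partialIsos L M).str φ) {i : (partialIsos L M).sig.Functions 1}
    {x y : X.carrier} (h : graphIn X i x y) : graphOn L M i (φ x) (φ y) :=
  hφ.map_op i _ y h

theorem mem_stalk {X : TopStr (partialIsos L M).sig} {φ : X.carrier → M}
    (hφ : TopStr.Preserves X (partialIsos L M).str φ)
    (x : X.carrier) : φ x ∈ stalk (graphIn X) (graphOn L M) x :=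
  fun _ y hy => ⟨φ y, graphOn_of_preserves hφ hy⟩

section

variable [Finite M] [Nonempty M] {X : TopStr (partialIsos L M).sig}

theorem graphIn_of_forall
    (hX : ∀ σ : UHSentence (partialIsos L M).sig, (partialIsos L M).str.Models σ → X.Models σ)
    {i : (partialIsos L M).sig.Functions 1} {x y : X.carrier}
    (h : ∀ φ, TopStr.Preserves X (partialIsos L M).str φ → graphOn L M i (φ x) (φ y)) :
    graphIn X i x y :=
  TopStr.mem_op_of_forall_preserves (Y := (partialIsos L M).str) hX i _ y h

variable [L.IsAlgebraic]

theorem isPartialAction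
    (hX : ∀ σ : UHSentence (partialIsos L M).sig, (partialIsos L M).str.Models σ → X.Models σ)
    (hb : X.IsBoolean) : IsPartialAction (graphIn X) (graphOn L M) where
  closed i := (hb.isClosed_graph i).preimage
    (f := fun p : X.carrier × X.carrier => ((fun _ => p.1 : Fin 1 → X.carrier), p.2)) (by fun_prop)
  unique h h' := Part.mem_unique h h'
  unique' h h' := graphOn_functional h h'
  one := by
    obtain ⟨m⟩ := ‹Nonempty M›
    obtain ⟨i, hi⟩ := exists_graphOn_iff (L := L) (ρ := fun m n : M => m = n) ⟨m, m, rfl⟩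
      (fun _ _ _ h h' => h.symm.trans h') (fun _ _ _ h h' => h.trans h'.symm)
      (fun f x y h => congrArg (funMap f) (funext h))
    exact ⟨i, fun x => graphIn_of_forall hX fun φ _ => (hi _ _).2 rfl, fun m n => (hi m n).1⟩
  comp := by
    intro i j x y z hxy hyz
    obtain ⟨φ, hφ⟩ := TopStr.exists_preserves (Y := (partialIsos L M).str) hX
    obtain ⟨k, hk⟩ := exists_graphOn_iff (L := L)
      (ρ := fun m n : M => ∃ l, graphOn L M i m l ∧ graphOn L M j l n)
      ⟨φ x, φ z, φ y, graphOn_of_preserves hφ hxy, graphOn_of_preserves hφ hyz⟩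
      (by
        rintro m n n' ⟨l, h1, h2⟩ ⟨l', h3, h4⟩
        obtain rfl := graphOn_functional h1 h3
        exact graphOn_functional h2 h4)
      (by
        rintro m m' n ⟨l, h1, h2⟩ ⟨l', h3, h4⟩
        obtain rfl := graphOn_injective h2 h4
        exact graphOn_injective h1 h3)
      (fun f x y h => by
        choose l h1 h2 using h
        exact ⟨_, graphOn_funMap f h1, graphOn_funMap f h2⟩)
    exact ⟨k, graphIn_of_forall hX fun φ hφ => (hk _ _).2
      ⟨φ y, graphOn_of_preserves hφ hxy, graphOn_of_preserves hφ hyz⟩, fun m n => (hk m n).1⟩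
  inv := by
    intro i
    obtain ⟨p, hp⟩ := i.2.2.1.1
    obtain ⟨j, hj⟩ := exists_graphOn_iff (L := L) (ρ := fun m n : M => graphOn L M i n m)
      ⟨p (Fin.last 1), p 0, by
        have : (fun _ : Fin 1 => p 0) = fun k => p k.castSucc := funext fun k => by
          rw [Subsingleton.elim k 0]; rfl
        unfold graphOn
        rw [this]
        exact hp⟩
      (fun _ _ _ h h' => graphOn_injective h h') (fun _ _ _ h h' => graphOn_functional h h')
      (fun f x y h => graphOn_funMap f h)
    refine ⟨j, fun x y => ⟨fun h => ?_, fun h => ?_⟩, fun m n => (hj n m).symm⟩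
    · exact graphIn_of_forall hX fun φ hφ => (hj _ _).2 (graphOn_of_preserves hφ h)
    · exact graphIn_of_forall hX fun φ hφ => (hj _ _).1 (graphOn_of_preserves hφ h)
  stalk_nonempty x := by
    obtain ⟨φ, hφ⟩ := TopStr.exists_preserves (Y := (partialIsos L M).str) hX
    exact ⟨_, mem_stalk hφ x⟩
  dom {i x} h := TopStr.exists_mem_op_of_forall_preserves (Y := (partialIsos L M).str) hX i
    (fun _ => x) fun φ hφ => h _ (mem_stalk hφ x)
  eq := by
    intro i j x y m n n' h1 h2 hm hn hn'
    obtain ⟨φ, hφ⟩ := TopStr.exists_preserves (Y := (partialIsos L M).str) hX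
    obtain ⟨k, hk⟩ := exists_graphOn_iff (L := L)
      (ρ := fun m n : M => m = n ∧ ∃ l, graphOn L M i m l ∧ graphOn L M j m l)
      ⟨φ x, φ x, rfl, φ y, graphOn_of_preserves hφ h1, graphOn_of_preserves hφ h2⟩
      (fun _ _ _ h h' => h.1.symm.trans h'.1) (fun _ _ _ h h' => h.1.trans h'.1.symm)
      (fun f x y h => by
        choose h l h3 h4 using h
        exact ⟨congrArg (funMap f) (funext h), _, graphOn_funMap f h3, graphOn_funMap f h4⟩)
    have h3 : graphIn X k x x := graphIn_of_forall hX fun φ hφ => (hk _ _).2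
      ⟨rfl, φ y, graphOn_of_preserves hφ h1, graphOn_of_preserves hφ h2⟩
    obtain ⟨l, hl⟩ := hm k x h3
    obtain ⟨-, l', h4, h5⟩ := (hk _ _).1 hl
    exact (graphOn_functional hn h4).trans (graphOn_functional h5 hn')

/-- The value of a nullary operation is fixed by equivariance, as its value in `M` is a one-element
subalgebra, the graph of a unary symbol. -/
theorem isMorphism_of_equivariant
    (hX : ∀ σ : UHSentence (partialIsos L M).sig, (partialIsos L M).str.Models σ → X.Models σ)
    {φ : X.carrier → (partialIsos L M).str.carrier} (hc : Continuous φ)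
    (he : IsEquivariantOn (graphIn X) (graphOn L M) Set.univ φ) :
    TopStr.IsMorphism X (partialIsos L M).str φ := by
  refine ⟨hc, fun {n} g x y hy => ?_, fun r => r.2.elim⟩
  obtain _ | _ | n := n
  · obtain ⟨p, hp⟩ := g.2.2.1.1
    have hg : ∀ m z, m ∈ g.1 z ↔ m = p (Fin.last 0) := fun m z => by
      have h1 : p (Fin.last 0) ∈ g.1 z := by
        rw [Subsingleton.elim z fun k => p k.castSucc]; exact hp
      exact ⟨fun h => Part.mem_unique h h1, fun h => h ▸ h1⟩
    obtain ⟨i, hi⟩ := exists_graphOn_iff (L := L)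
      (ρ := fun m n : M => m = p (Fin.last 0) ∧ n = p (Fin.last 0)) ⟨_, _, rfl, rfl⟩
      (fun _ _ _ h h' => h.2.trans h'.2.symm) (fun _ _ _ h h' => h.1.trans h'.1.symm)
      (fun f x y h => by
        have h1 : funMap f (fun _ => p (Fin.last 0)) = p (Fin.last 0) :=
          (hg _ Fin.elim0).1 <| by
            have := g.2.2.1.funMap_mem f (fun _ => Fin.elim0) (fun _ => p (Fin.last 0))
              fun k => (hg _ _).2 rfl
            rwa [Subsingleton.elim (fun i : Fin 0 => funMap f fun k => _) Fin.elim0] at this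
        obtain rfl : x = fun _ => p (Fin.last 0) := funext fun j => (h j).1
        obtain rfl : y = fun _ => p (Fin.last 0) := funext fun j => (h j).2
        exact ⟨h1, h1⟩)
    have h2 : graphIn X i y y := graphIn_of_forall hX fun ψ hψ => by
      have h3 := (hg _ _).1 (hψ.map_op g x y hy)
      exact (hi _ _).2 ⟨h3, h3⟩
    exact (hg _ _).2 ((hi _ _).1 (he i y y trivial h2)).1
  · have h1 : ∀ {Z : Type u} (x : Fin 1 → Z), x = fun _ => x 0 := fun x =>
      funext fun k => by rw [Subsingleton.elim k 0]
    rw [h1 x] at hy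
    rw [h1 fun k => φ (x k)]
    exact he g (x 0) y trivial hy
  · exact absurd g.2.1 (by omega)

/-- At two points, a map that preserves the structure can be replaced by a morphism: extend from
the orbits of the two points. -/
theorem exists_isMorphism_eq₂
    (hX : ∀ σ : UHSentence (partialIsos L M).sig, (partialIsos L M).str.Models σ → X.Models σ)
    (hb : X.IsBoolean) {φ : X.carrier → (partialIsos L M).str.carrier}
    (hφ : TopStr.Preserves X (partialIsos L M).str φ) (x y : X.carrier) :
    ∃ u, TopStr.IsMorphism X (partialIsos L M).str u ∧ u x = φ x ∧ u y = φ y := by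
  have := hb.compact
  have := hb.hausdorff
  have := hb.totallyDisconnected
  let N := (partialIsos L M).str.carrier
  have H : IsPartialAction (M := N) (graphIn X) (graphOn L M) := isPartialAction (M := M) hX hb
  obtain ⟨Y, u, h1, h2, -, h3, h4, -, h5, h6, h7⟩ := H.exists_extend_orbit isClosed_empty
    (fun _ _ _ h => h.elim) (u := φ) (continuousOn_empty φ) (fun _ _ _ h => h.elim)
    (Set.notMem_empty x) (mem_stalk hφ x)
  obtain ⟨i, hi, -⟩ := H.one
  have hxY : x ∈ Y := (h6 i x (φ x) (hi x)).1
  obtain ⟨Y', u', h1', h2', h3', h4', h5', h6'⟩ : ∃ (Y' : Set X.carrier) (u' : X.carrier → N),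
      IsClosed Y' ∧ Invariant (graphIn X) Y' ∧ ContinuousOn u' Y' ∧
      IsEquivariantOn (graphIn X) (graphOn L M) Y' u' ∧ (x ∈ Y' ∧ u' x = φ x) ∧
      (y ∈ Y' ∧ u' y = φ y) := by
    by_cases hy : y ∈ Y
    · obtain h | ⟨j, hj⟩ := h5 y hy
      · exact h.elim
      · exact ⟨Y, u, h1, h2, h3, h4, ⟨hxY, h7⟩, hy,
          (h6 j y (φ y) hj).2 (graphOn_of_preserves hφ hj)⟩
    · obtain ⟨Y', u', k1, k2, k3, k4, k5, k6, -, k7, k8⟩ :=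
        H.exists_extend_orbit h1 h2 h3 h4 hy (mem_stalk hφ y)
      exact ⟨Y', u', k1, k2, k4, k5, ⟨k3 hxY, (k6 hxY).trans h7⟩, (k7 i y (φ y) (hi y)).1, k8⟩
  obtain ⟨v, hv, hve, hvu⟩ := H.exists_extend h1' h2' h3' h4'
  exact ⟨v, isMorphism_of_equivariant hX hv hve, (hvu h5'.1).trans h5'.2,
    (hvu h6'.1).trans h6'.2⟩

theorem exists_isMorphism
    (hX : ∀ σ : UHSentence (partialIsos L M).sig, (partialIsos L M).str.Models σ → X.Models σ)
    (hb : X.IsBoolean) : ∃ u, TopStr.IsMorphism X (partialIsos L M).str u := by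
  have := hb.compact
  have := hb.hausdorff
  have := hb.totallyDisconnected
  let N := (partialIsos L M).str.carrier
  have H : IsPartialAction (M := N) (graphIn X) (graphOn L M) := isPartialAction (M := M) hX hb
  obtain ⟨φ, hφ⟩ := TopStr.exists_preserves (Y := (partialIsos L M).str) hX
  obtain ⟨v, hv, hve, -⟩ := H.exists_extend isClosed_empty
    (fun _ _ _ h => h.elim) (u := φ) (continuousOn_empty φ) (fun _ _ _ h => h.elim)
  exact ⟨v, isMorphism_of_equivariant hX hv hve⟩

theorem exists_isMorphism_eq
    (hX : ∀ σ : UHSentence (partialIsos L M).sig, (partialIsos L M).str.Models σ → X.Models σ)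
    (hb : X.IsBoolean) {φ : X.carrier → (partialIsos L M).str.carrier}
    (hφ : TopStr.Preserves X (partialIsos L M).str φ) {n : ℕ}
    (g : (partialIsos L M).sig.Functions n) (x : Fin n → X.carrier) :
    ∃ u, TopStr.IsMorphism X (partialIsos L M).str u ∧ (fun k => u (x k)) = fun k => φ (x k) := by
  obtain _ | _ | n := n
  · obtain ⟨u, hu⟩ := exists_isMorphism hX hb
    exact ⟨u, hu, Subsingleton.elim _ _⟩
  · obtain ⟨u, hu, h1, -⟩ := exists_isMorphism_eq₂ hX hb hφ (x 0) (x 0)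
    exact ⟨u, hu, funext fun k => (Fin.fin_one_eq_zero k).symm ▸ h1⟩
  · exact absurd g.2.1 (by omega)

theorem eq_of_forall_isMorphism
    (hX : ∀ σ : UHSentence (partialIsos L M).sig, (partialIsos L M).str.Models σ → X.Models σ)
    (hb : X.IsBoolean) {x y : X.carrier}
    (h : ∀ u, TopStr.IsMorphism X (partialIsos L M).str u → u x = u y) : x = y :=
  TopStr.eq_of_forall_preserves (Y := (partialIsos L M).str) hX fun φ hφ => by
    obtain ⟨u, hu, h1, h2⟩ := exists_isMorphism_eq₂ hX hb hφ x y
    rw [← h1, ← h2]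
    exact h u hu

theorem exists_mem_op_of_forall_isMorphism
    (hX : ∀ σ : UHSentence (partialIsos L M).sig, (partialIsos L M).str.Models σ → X.Models σ)
    (hb : X.IsBoolean) {n : ℕ} (g : (partialIsos L M).sig.Functions n) (x : Fin n → X.carrier)
    (h : ∀ u, TopStr.IsMorphism X (partialIsos L M).str u →
      ∃ z, z ∈ (partialIsos L M).str.op g (fun k => u (x k))) : ∃ y, y ∈ X.op g x :=
  TopStr.exists_mem_op_of_forall_preserves (Y := (partialIsos L M).str) hX g x fun φ hφ => by
    obtain ⟨u, hu, he⟩ := exists_isMorphism_eq hX hb hφ g x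
    rw [← he]
    exact h u hu

theorem mem_op_of_forall_isMorphism
    (hX : ∀ σ : UHSentence (partialIsos L M).sig, (partialIsos L M).str.Models σ → X.Models σ)
    (hb : X.IsBoolean) {n : ℕ} (g : (partialIsos L M).sig.Functions n) (x : Fin n → X.carrier)
    (y : X.carrier) (h : ∀ u, TopStr.IsMorphism X (partialIsos L M).str u →
      u y ∈ (partialIsos L M).str.op g (fun k => u (x k))) : y ∈ X.op g x := by
  obtain ⟨y', hy'⟩ := exists_mem_op_of_forall_isMorphism hX hb g x fun u hu => ⟨_, h u hu⟩
  obtain rfl : y' = y := eq_of_forall_isMorphism hX hb fun u hu =>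
    Part.mem_unique (hu.map_op g x y' hy') (h u hu)
  exact hy'

end

/-- This holds for every finite algebra; quasi-primality only matters for the duality. -/
theorem isStandard [L.IsAlgebraic] [Finite M] [Nonempty M] : (partialIsos L M).IsStandard := by
  refine fun X => ⟨fun h => ⟨h.isBoolean, h.models⟩, fun ⟨hb, hX⟩ => ?_⟩
  have := hb.compact
  obtain ⟨u₀, hu₀⟩ := exists_isMorphism hX hb
  have : Nonempty {u // TopStr.IsMorphism X (partialIsos L M).str u} := ⟨⟨u₀, hu₀⟩⟩
  exact TopStr.InIScP.of_family
    (e := fun u : {u // TopStr.IsMorphism X (partialIsos L M).str u} => u.1) (fun u => u.2)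
    (fun x y hxy => eq_of_forall_isMorphism hX hb fun u hu => congrFun hxy ⟨u, hu⟩)
    (fun g x h => exists_mem_op_of_forall_isMorphism hX hb g x fun u hu => h ⟨u, hu⟩)
    (fun r => r.2.elim)

end partialIsos

/-! ### Quasi-primal algebras -/

section Discriminator

variable {L : FirstOrder.Language.{v, w}} {M : Type u} [L.Structure M]

/-- The term `t` realizes the ternary discriminator on `M`. -/
def IsDiscriminator (M : Type u) [L.Structure M] (t : L.Term (Fin 3)) : Prop :=
  ∀ x y z : M, (x ≠ y → t.realize ![x, y, z] = x) ∧ (x = y → t.realize ![x, y, z] = z)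

/-- The value of a ternary term. -/
def disc (t : L.Term (Fin 3)) {A : Type*} [L.Structure A] (x y z : A) : A := t.realize ![x, y, z]

/-- The switching term of a discriminator. -/
def switch (t : L.Term (Fin 3)) {A : Type*} [L.Structure A] (x y z w : A) : A :=
  disc t (disc t x y z) (disc t x y w) w

/-- Pixley's majority term of a discriminator. -/
def maj (t : L.Term (Fin 3)) {A : Type*} [L.Structure A] (x y z : A) : A :=
  disc t x (disc t x y z) z

variable {t : L.Term (Fin 3)} {A : Type*} [L.Structure A]

theorem map_disc (f : A →[L] M) (x y z : A) :
    f (disc t x y z) = disc t (f x) (f y) (f z) := by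
  unfold disc
  rw [← FirstOrder.Language.HomClass.realize_term f]
  congr 1
  funext i
  fin_cases i <;> rfl

theorem IsDiscriminator.disc_of_ne (ht : IsDiscriminator M t) {x y : M} (h : x ≠ y) (z : M) :
    disc t x y z = x := (ht x y z).1 h

theorem IsDiscriminator.disc_self (ht : IsDiscriminator M t) (x z : M) :
    disc t x x z = z := (ht x x z).2 rfl

theorem IsDiscriminator.map_switch_of_eq (ht : IsDiscriminator M t) (f : A →[L] M) {x y : A}
    (h : f x = f y) (z w : A) : f (switch t x y z w) = f z := by
  simp only [switch, map_disc, h, ht.disc_self]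
  by_cases hzw : f z = f w
  · rw [hzw, ht.disc_self]
  · rw [ht.disc_of_ne hzw]

theorem IsDiscriminator.map_switch_of_ne (ht : IsDiscriminator M t) (f : A →[L] M) {x y : A}
    (h : f x ≠ f y) (z w : A) : f (switch t x y z w) = f w := by
  simp only [switch, map_disc, ht.disc_of_ne h, ht.disc_self]

theorem IsDiscriminator.map_maj₁₂ (ht : IsDiscriminator M t) (f : A →[L] M) {x y z : A} {m : M}
    (hx : f x = m) (hy : f y = m) : f (maj t x y z) = m := by
  simp only [maj, map_disc, hx, hy, ht.disc_self]
  by_cases h : m = f z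
  · rw [← h, ht.disc_self]
  · rw [ht.disc_of_ne h]

theorem IsDiscriminator.map_maj₂₃ (ht : IsDiscriminator M t) (f : A →[L] M) {x y z : A} {m : M}
    (hy : f y = m) (hz : f z = m) : f (maj t x y z) = m := by
  simp only [maj, map_disc, hy, hz]
  by_cases h : f x = m
  · rw [h, ht.disc_self, ht.disc_self]
  · rw [ht.disc_of_ne h, ht.disc_self]

theorem IsDiscriminator.map_maj₁₃ (ht : IsDiscriminator M t) (f : A →[L] M) {x y z : A} {m : M}
    (hx : f x = m) (hz : f z = m) : f (maj t x y z) = m := by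
  simp only [maj, map_disc, hx, hz]
  by_cases h : m = disc t m (f y) m
  · rw [← h, ht.disc_self]
  · rw [ht.disc_of_ne h]

/-- A pair of homomorphisms, the second of which is not a function of the first one, has
a rectangular image. -/
theorem IsDiscriminator.exists_rectangular (ht : IsDiscriminator M t) {f g : A →[L] M} {a a' : A}
    (hf : f a = f a') (hg : g a ≠ g a') (b c : A) : ∃ e, f e = f b ∧ g e = g c := by
  have h1 : ∀ d, f (disc t a a' d) = f d ∧ g (disc t a a' d) = g a := fun d => by
    simp only [map_disc, hf, ht.disc_self, ht.disc_of_ne hg, and_self]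
  by_cases h : g c = g a
  · exact ⟨_, (h1 b).1, (h1 b).2.trans h.symm⟩
  · refine ⟨disc t c (disc t a a' c) b, ?_, ?_⟩
    · rw [map_disc, (h1 c).1, ht.disc_self]
    · rw [map_disc, (h1 c).2, ht.disc_of_ne h]

/-- Baker–Pixley: if a function `u` on a set of homomorphisms agrees with evaluations on pairs of
classes of `κ`, then it agrees with an evaluation on finitely many classes. -/
theorem IsDiscriminator.exists_interpolation (ht : IsDiscriminator M t) [Nonempty A]
    {D K : Type*} (h : D → A →[L] M) (κ : D → K) (u : D → M)
    (hpair : ∀ x y, ∃ a, ∀ z, κ z = κ x ∨ κ z = κ y → u z = h z a) (T : Finset D) :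
    ∃ a, ∀ z, (∃ x ∈ T, κ z = κ x) → u z = h z a := by
  classical
  induction hn : T.card using Nat.strong_induction_on generalizing T with
  | _ n ih =>
    by_cases h3 : T.card ≤ 2
    · obtain rfl | ⟨x, hx⟩ := T.eq_empty_or_nonempty
      · exact ⟨Classical.arbitrary A, fun z ⟨x, hx, _⟩ => absurd hx (Finset.notMem_empty x)⟩
      · have h4 : ∃ y, T ⊆ {x, y} := by
          have h5 : (T.erase x).card ≤ 1 := by
            rw [Finset.card_erase_of_mem hx]; omega
          have : Nonempty D := ⟨x⟩
          obtain ⟨y, hy⟩ := Finset.card_le_one_iff_subset_singleton.1 h5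
          exact ⟨y, fun z hz => by
            by_cases hzx : z = x
            · simp [hzx]
            · simpa [hzx] using hy (Finset.mem_erase.2 ⟨hzx, hz⟩)⟩
        obtain ⟨y, hy⟩ := h4
        obtain ⟨a, ha⟩ := hpair x y
        refine ⟨a, fun z ⟨w, hw, hzw⟩ => ha z ?_⟩
        have := hy hw
        simp only [Finset.mem_insert, Finset.mem_singleton] at this
        obtain rfl | rfl := this
        · exact Or.inl hzw
        · exact Or.inr hzw
    · obtain ⟨p, q, r, hp, hq, hr, hpq, hpr, hqr⟩ := Finset.two_lt_card_iff.1 (not_le.1 h3)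
      have h4 : ∀ p ∈ T, ∃ a, ∀ z, (∃ x ∈ T.erase p, κ z = κ x) → u z = h z a := fun p hp =>
        ih _ (hn ▸ Finset.card_erase_lt_of_mem hp) _ rfl
      obtain ⟨a, ha⟩ := h4 p hp
      obtain ⟨b, hb⟩ := h4 q hq
      obtain ⟨c, hc⟩ := h4 r hr
      refine ⟨maj t a b c, fun z ⟨x, hx, hzx⟩ => ?_⟩
      have key : ∀ {p a}, (∀ z, (∃ x ∈ T.erase p, κ z = κ x) → u z = h z a) → x ≠ p →
          h z a = u z := fun h5 hxp => (h5 z ⟨x, Finset.mem_erase.2 ⟨hxp, hx⟩, hzx⟩).symm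
      by_cases hxp : x = p
      · subst hxp
        exact (ht.map_maj₂₃ _ (key hb hpq) (key hc hpr)).symm
      · by_cases hxq : x = q
        · subst hxq
          exact (ht.map_maj₁₃ _ (key ha hxp) (key hc hqr)).symm
        · exact (ht.map_maj₁₂ _ (key ha hxp) (key hb hxq)).symm

end Discriminator

/-! ### Full duality for quasi-primal algebras -/

namespace partialIsos

variable {L : FirstOrder.Language.{v, w}} [L.IsAlgebraic] {M : Type u} [L.Structure M]
  {t : L.Term (Fin 3)}

/-- A map on the dual of `A` that preserves partial bijections agrees with an evaluation at any two
points: a binary compatible relation is either rectangular or the graph of a partial bijection. -/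
theorem exists_eval₂ (ht : IsDiscriminator M t) {A : Type u} [L.Structure A] [Nonempty A]
    {u : ((partialIsos L M).dual A).carrier → M}
    (hu : TopStr.Preserves ((partialIsos L M).dual A) (partialIsos L M).str u) (f g : A →[L] M) :
    ∃ a, u ((partialIsos L M).pt f) = f a ∧ u ((partialIsos L M).pt g) = g a := by
  have key : ∀ f g : A →[L] M, (∀ a a', f a = f a' ↔ g a = g a') →
      ∃ a, u ((partialIsos L M).pt f) = f a ∧ u ((partialIsos L M).pt g) = g a := by
    intro f g hfg
    obtain ⟨i, hi⟩ := exists_graphOn_iff (L := L)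
      (ρ := fun m n : M => ∃ a, m = f a ∧ n = g a)
      ⟨_, _, Classical.arbitrary A, rfl, rfl⟩
      (by
        rintro _ _ _ ⟨a, rfl, rfl⟩ ⟨a', h, rfl⟩
        exact (hfg a a').1 h)
      (by
        rintro _ _ _ ⟨a, rfl, rfl⟩ ⟨a', rfl, h⟩
        exact (hfg a a').2 h)
      (fun F x y h => by
        choose a ha hb using h
        obtain rfl : x = fun j => f (a j) := funext ha
        obtain rfl : y = fun j => g (a j) := funext hb
        exact ⟨funMap F a, (f.map_fun F a).symm, (g.map_fun F a).symm⟩)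
    exact (hi _ _).1 <| graphOn_of_preserves hu
      (x := (partialIsos L M).pt f) (y := (partialIsos L M).pt g) <|
      AlterEgo.mem_op_dual.2 fun a => (hi _ _).2 ⟨a, rfl, rfl⟩
  by_cases h : ∀ a a', f a = f a' ↔ g a = g a'
  · exact key f g h
  obtain ⟨b, hb, -⟩ := key f f fun _ _ => Iff.rfl
  obtain ⟨c, hc, -⟩ := key g g fun _ _ => Iff.rfl
  rw [hb, hc]
  push Not at h
  obtain ⟨a, a', ⟨h1, h2⟩ | ⟨h1, h2⟩⟩ := h
  · obtain ⟨e, he, he'⟩ := ht.exists_rectangular h1 h2 b c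
    exact ⟨e, he.symm, he'.symm⟩
  · obtain ⟨e, he, he'⟩ := ht.exists_rectangular h2 h1 c b
    exact ⟨e, he'.symm, he.symm⟩

theorem dualises [Finite M] [Nonempty M] (ht : IsDiscriminator M t) :
    (partialIsos L M).Dualises := by
  classical
  intro A _ hA
  have := hA.1
  refine (AlterEgo.evalAlgIso_iff hA).2 fun u hu => ?_
  let D := ((partialIsos L M).dual A).carrier
  have : CompactSpace D := ((partialIsos L M).inIScP_dual A).isBoolean.compact
  have hev : ∀ a, Continuous fun x : D => (x.1 a : (partialIsos L M).str.carrier) := fun a =>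
    ((partialIsos L M).isMorphism_eval A a).continuous
  -- By compactness, finitely many evaluations suffice to interpolate `u` on all pairs.
  obtain ⟨F, hF⟩ := isCompact_univ.elim_finite_subcover
    (fun a : A => {p : D × D | u p.1 = p.1.1 a ∧ u p.2 = p.2.1 a})
    (fun a => by
      have h1 : Continuous fun p : D × D => (u p.1, p.1.1 a, u p.2, p.2.1 a) :=
        (hu.continuous.comp continuous_fst).prodMk (((hev a).comp continuous_fst).prodMk
          ((hu.continuous.comp continuous_snd).prodMk ((hev a).comp continuous_snd)))
      exact (isOpen_discrete {q : (partialIsos L M).str.carrier × (partialIsos L M).str.carrier ×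
        (partialIsos L M).str.carrier × (partialIsos L M).str.carrier |
        q.1 = q.2.1 ∧ q.2.2.1 = q.2.2.2}).preimage h1)
    (fun p _ => by
      obtain ⟨f, hf⟩ := AlterEgo.exists_pt p.1
      obtain ⟨g, hg⟩ := AlterEgo.exists_pt p.2
      obtain ⟨a, ha⟩ := exists_eval₂ ht hu.preserves f g
      refine Set.mem_iUnion.2 ⟨a, ?_⟩
      rw [← hf, ← hg] at ha
      exact ⟨ha.1.trans (by rw [hf]; rfl), ha.2.trans (by rw [hg]; rfl)⟩)
  have hF' : ∀ x y : D, ∃ a ∈ F, u x = x.1 a ∧ u y = y.1 a := fun x y => by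
    obtain ⟨a, h1, h2, h3⟩ := by simpa using hF (Set.mem_univ (x, y))
    exact ⟨a, h2, h1, h3⟩
  choose h hh using fun x : D => AlterEgo.exists_pt x
  have hval : ∀ (x : D) a, h x a = x.1 a := fun x a =>
    (congrFun (congrArg Subtype.val (hh x)) a).symm
  let κ : D → F → M := fun x a => x.1 a
  have hκ : ∀ {x y : D}, κ x = κ y → u x = u y := fun {x y} hxy => by
    obtain ⟨a, ha, h1, h2⟩ := hF' x y
    exact h1.trans ((congrFun hxy ⟨a, ha⟩).trans h2.symm)
  choose s hs using fun k : Set.range κ => k.2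
  obtain ⟨a, ha⟩ := ht.exists_interpolation h κ u (fun x y => by
    obtain ⟨a, ha, h1, h2⟩ := hF' x y
    refine ⟨a, fun z hz => ?_⟩
    rw [hval]
    obtain hz | hz := hz
    · exact (hκ hz).trans (h1.trans (congrFun hz ⟨a, ha⟩).symm)
    · exact (hκ hz).trans (h2.trans (congrFun hz ⟨a, ha⟩).symm))
    (Set.finite_range s).toFinset
  refine ⟨a, fun x => (ha x ⟨s ⟨κ x, x, rfl⟩, by simp, (hs ⟨κ x, x, rfl⟩).symm⟩).trans (hval x a)⟩

/-- Each homomorphism `α` from the predual to `M` is an evaluation. The discriminator and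
compactness give a point `x` such that `α` has the same kernel as the evaluation at `x`; then some
partial bijection `h` satisfies `α u = h (u x)`, and `α` is the evaluation at `h x`. -/
theorem exists_eval_of_hom [Finite M] [Nonempty M] (ht : IsDiscriminator M t)
    {X : TopStr (partialIsos L M).sig}
    (hX : ∀ σ : UHSentence (partialIsos L M).sig, (partialIsos L M).str.Models σ → X.Models σ)
    (hb : X.IsBoolean) (α : (partialIsos L M).predual X →[L] M) : ∃ x, ∀ u, α u = u.1 x := by
  have := hb.compact
  let E := (partialIsos L M).predual X
  let ev : X.carrier → E →[L] M := fun x => coordHom _ x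
  have hev : ∀ u : E, Continuous (Y := (partialIsos L M).str.carrier) fun x => ev x u := fun u =>
    u.2.continuous
  obtain ⟨w₀, hw₀⟩ := exists_isMorphism hX hb
  by_cases hconst : ∀ u v : E, α u = α v
  · -- A constant homomorphism is the evaluation at the value of a nullary operation.
    let c : M := α ⟨w₀, hw₀⟩
    have hc : ∀ u, α u = c := fun u => hconst u _
    let g : (Fin 0 → M) →. M := fun _ => Part.some c
    have hg : g ∈ (partialIsos L M).H 0 := by
      refine ⟨Nat.zero_le 1, ⟨⟨fun _ => c, Part.mem_some c⟩, ⟨graphRel g, fun {k} f x hx => ?_⟩, rfl⟩,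
        fun _ _ _ _ _ => Subsingleton.elim _ _⟩
      refine Part.mem_some_iff.2 ?_
      have h1 : ∀ j, x j (Fin.last 0) = c := fun j => Part.mem_some_iff.1 (hx j)
      have h2 := α.map_fun f fun _ => ⟨w₀, hw₀⟩
      rw [hc] at h2
      change funMap f (fun j => x j (Fin.last 0)) = c
      rw [funext h1]
      exact h2.symm
    obtain ⟨y, hy⟩ := exists_mem_op_of_forall_isMorphism hX hb
      (⟨g, hg⟩ : (partialIsos L M).sig.Functions 0) Fin.elim0
      fun u _ => ⟨c, Part.mem_some c⟩
    exact ⟨y, fun u => (hc u).trans (Part.mem_some_iff.1 (u.2.map_op _ _ y hy)).symm⟩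
  push Not at hconst
  obtain ⟨u₀, v₀, h₀⟩ := hconst
  obtain ⟨x, hx⟩ : ∃ x, (∀ w z : E, α w = α z → ev x w = ev x z) ∧ ev x u₀ ≠ ev x v₀ := by
    let I := {p : E × E // α p.1 = α p.2}
    have : Nonempty I := ⟨⟨(u₀, u₀), rfl⟩⟩
    have hcl : ∀ p : I, IsClosed {x | ev x p.1.1 = ev x p.1.2 ∧ ev x u₀ ≠ ev x v₀} := fun p =>
      (isClosed_discrete {q : ((partialIsos L M).str.carrier × (partialIsos L M).str.carrier) ×
        (partialIsos L M).str.carrier × (partialIsos L M).str.carrier |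
          q.1.1 = q.1.2 ∧ q.2.1 ≠ q.2.2}).preimage
        (((hev p.1.1).prodMk (hev p.1.2)).prodMk ((hev u₀).prodMk (hev v₀)))
    obtain ⟨x, hx⟩ := IsCompact.nonempty_iInter_of_directed_nonempty_isCompact_isClosed
      (fun p : I => {x | ev x p.1.1 = ev x p.1.2 ∧ ev x u₀ ≠ ev x v₀})
      (by
        rintro ⟨⟨w, z⟩, h1⟩ ⟨⟨w', z'⟩, h2⟩
        -- The equalizer of these two elements is the intersection of the two equalizers.
        refine ⟨⟨(switch t w z w' w, switch t w z z' z), ?_⟩, ?_, ?_⟩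
        · change α (switch t w z w' w) = α (switch t w z z' z)
          rw [ht.map_switch_of_eq α h1, ht.map_switch_of_eq α h1]
          exact h2
        · rintro x ⟨h3, h4⟩
          refine ⟨?_, h4⟩
          by_contra h5
          change ev x (switch t w z w' w) = ev x (switch t w z z' z) at h3
          rw [ht.map_switch_of_ne _ h5, ht.map_switch_of_ne _ h5] at h3
          exact h5 h3
        · rintro x ⟨h3, h4⟩
          refine ⟨?_, h4⟩
          change ev x (switch t w z w' w) = ev x (switch t w z z' z) at h3
          by_cases h5 : ev x w = ev x z
          · rw [ht.map_switch_of_eq _ h5, ht.map_switch_of_eq _ h5] at h3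
            exact h3
          · rw [ht.map_switch_of_ne _ h5, ht.map_switch_of_ne _ h5] at h3
            exact absurd h3 h5)
      (by
        rintro ⟨⟨w, z⟩, h1⟩
        by_contra hne
        rw [Set.not_nonempty_iff_eq_empty, Set.eq_empty_iff_forall_notMem] at hne
        have h2 : switch t w z u₀ w = switch t w z v₀ w := by
          refine Subtype.ext (funext fun x => ?_)
          change ev x (switch t w z u₀ w) = ev x (switch t w z v₀ w)
          by_cases h5 : ev x w = ev x z
          · rw [ht.map_switch_of_eq _ h5, ht.map_switch_of_eq _ h5]
            by_contra h6
            exact hne x ⟨h5, h6⟩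
          · rw [ht.map_switch_of_ne _ h5, ht.map_switch_of_ne _ h5]
        have h3 := congrArg α h2
        rw [ht.map_switch_of_eq α h1, ht.map_switch_of_eq α h1] at h3
        exact h₀ h3)
      (fun p => (hcl p).isCompact) hcl
    rw [Set.mem_iInter] at hx
    exact ⟨x, fun w z h => (hx ⟨(w, z), h⟩).1, (hx ⟨(u₀, u₀), rfl⟩).2⟩
  have hx' : ∀ w z : E, ev x w = ev x z → α w = α z := by
    intro w z h1
    by_contra h2
    have h3 : ∀ y, ev x w = ev x y := fun y => by
      have h4 := hx.1 w (disc t w z y) (by rw [map_disc, ht.disc_of_ne h2])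
      rwa [map_disc, h1, ht.disc_self, ← h1] at h4
    exact hx.2 ((h3 u₀).symm.trans (h3 v₀))
  obtain ⟨i, hi⟩ := exists_graphOn_iff (L := L)
    (ρ := fun m n : M => ∃ u : E, m = ev x u ∧ n = α u)
    ⟨_, _, u₀, rfl, rfl⟩
    (by
      rintro _ _ _ ⟨a, rfl, rfl⟩ ⟨a', h, rfl⟩
      exact hx' a a' h)
    (by
      rintro _ _ _ ⟨a, rfl, rfl⟩ ⟨a', rfl, h⟩
      exact hx.1 a a' h)
    (fun F y z h => by
      choose a ha hb using h
      obtain rfl : y = fun j => ev x (a j) := funext ha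
      obtain rfl : z = fun j => α (a j) := funext hb
      exact ⟨funMap F a, ((ev x).map_fun F a).symm, (α.map_fun F a).symm⟩)
  obtain ⟨y, hy⟩ := exists_mem_op_of_forall_isMorphism hX hb i (fun _ => x) fun u hu =>
    ⟨α ⟨u, hu⟩, (hi _ _).2 ⟨⟨u, hu⟩, rfl, rfl⟩⟩
  refine ⟨y, fun u => ?_⟩
  obtain ⟨v, hv, hv'⟩ := (hi _ _).1 (u.2.map_op i (fun _ => x) y hy)
  rw [hv']
  exact hx' u v hv

theorem fullyDualises [Finite M] [Nonempty M] (ht : IsDiscriminator M t) :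
    (partialIsos L M).FullyDualises := by
  refine ⟨dualises ht, fun X hXI => ?_⟩
  have hb := hXI.isBoolean
  have hX := hXI.models
  have := hb.compact
  exact AlterEgo.evalStrIso_of_compact (exists_eval_of_hom ht hX hb)
    (fun x y h => eq_of_forall_isMorphism hX hb fun u hu => h ⟨u, hu⟩)
    (fun g x y h => mem_op_of_forall_isMorphism hX hb g x y fun u hu => h ⟨u, hu⟩)
    (fun r => r.2.elim)

end partialIsos

end NatDual

theorem theorem6p2 (L : FirstOrder.Language.{v, w}) [L.IsAlgebraic]
    (M : Type u) [L.Structure M] [Finite M] [Nonempty M] :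
    ((∃ 𝕄₁ : NatDual.AlterEgo L M, 𝕄₁.IsStandard ∧ 𝕄₁.FullyDualises) →
      ∀ 𝕄 : NatDual.AlterEgo L M, 𝕄.FullyDualisesFin → 𝕄.IsStandard ∧ 𝕄.FullyDualises) ∧
    (NatDual.IsQuasiPrimal L M →
      ∀ 𝕄 : NatDual.AlterEgo L M, 𝕄.FullyDualisesFin → 𝕄.IsStandard ∧ 𝕄.FullyDualises) := by
  refine ⟨?_, ?_⟩
  · rintro ⟨𝕄₁, hs, hf⟩ 𝕄 h
    exact h.isStandard_and_fullyDualises hs hf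
  · rintro ⟨-, t, ht⟩ 𝕄 h
    exact h.isStandard_and_fullyDualises NatDual.partialIsos.isStandard
      (NatDual.partialIsos.fullyDualises ht)
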